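/- For an integer $m$ put $[m]=\frac{1-q^m}{1-q}$, let $(x;y)_k=\prod_{i=0}^{k-1}(1-xy^i)$, and let $\Phi_n(q)$ be the $n$-th cyclotomic polynomial. For rational functions $A,B\in\mathbb{Q}(q)$ and a polynomial $P\in\mathbb{Q}[q]$, write $A\equiv B\pmod P$ if $A-B=Pu/v$ with $u,v\in\mathbb{Q}[q]$ and $v$ coprime to $P$. Theorem 5.2. Let $r\in\{1,-1\}$ and let $n,d$ be integers such that $n+r\ge d\ge 3$, $\gcd(n,d)=1$ and $n\equiv -r\pmod d$. Put $N=(dn-n-r)/d$, and let $M=N$ or $M=n-1$. Then, modulo $[n]\Phi_n(q)^5$, $$\sum_{k=0}^{M}[2dk+r]\frac{(q^r;q^d)_k^6}{(q^d;q^d)_k^6}\,q^{(2d-3r)k} \equiv [dn-n]\,q^{r(r+n-dn)/d}\,\frac{(q^{2r};q^d)_{N}}{(q^d;q^d)_{N}} \sum_{k=0}^{N}\frac{(q^r;q^d)_k^3\,(q^{d-r};q^d)_k\,q^{dk}}{(q^d;q^d)_k^3\,(q^{2r};q^d)_k} \left\{1-[dn-n]^2\,(2-q^{dn-n})\sum_{j=1}^{k}\left(\frac{q^{dj}}{[dj]^2}+\frac{q^{dj-d+r}}{[dj-d+r]^2}\right)\right\}.$$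 -/

import Mathlib

open Finset

noncomputable section

namespace QSeries

/-- The indeterminate `q`, as an element of the field `ℚ(q)` of rational functions. -/
abbrev q : RatFunc ℚ := RatFunc.X

/-- The `q`-integer `[m] = (1 - q^m) / (1 - q)` for an arbitrary integer `m`. -/
def qInt (m : ℤ) : RatFunc ℚ := (1 - q ^ m) / (1 - q)

/-- The `q`-shifted factorial `(x; y)_k = (1 - x)(1 - x y) ⋯ (1 - x y^(k-1))`. -/
def qPoch (x y : RatFunc ℚ) (k : ℕ) : RatFunc ℚ := ∏ i ∈ range k, (1 - x * y ^ i)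

/-- The `q`-integer `[n] = 1 + q + ⋯ + q^(n-1)` as a polynomial, for a natural number `n`. -/
def qIntPoly (n : ℕ) : Polynomial ℚ := ∑ i ∈ range n, Polynomial.X ^ i

/-- The modulus `[n] Φ_n(q)^5`. -/
def modulus (n : ℕ) : Polynomial ℚ := qIntPoly n * Polynomial.cyclotomic n ℚ ^ 5

/-- Congruence of rational functions modulo a polynomial `P`: the difference is
`P * u / v` with polynomials `u`, `v` such that `v` is coprime to `P`. -/
def RatCongr (P : Polynomial ℚ) (A B : RatFunc ℚ) : Prop :=
  ∃ u v : Polynomial ℚ, IsCoprime v P ∧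
    A - B = algebraMap (Polynomial ℚ) (RatFunc ℚ) (P * u) /
      algebraMap (Polynomial ℚ) (RatFunc ℚ) v

/-- The index `(dn - n - r) / d`; the division is exact and the quotient is nonnegative
in the situation of interest, see `mul_topIndex`. -/
def topIndex (n d : ℕ) (r : ℤ) : ℕ := (((d : ℤ) * n - n - r) / d).toNat

/-- The left-hand side `∑_{k=0}^{M} [2dk+r] (q^r;q^d)_k^6 / (q^d;q^d)_k^6 q^((2d-3r)k)`. -/
def lhsSum (d : ℕ) (r : ℤ) (M : ℕ) : RatFunc ℚ :=
  ∑ k ∈ range (M + 1),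
    qInt (2 * d * k + r) * (qPoch (q ^ r) (q ^ d) k ^ 6 / qPoch (q ^ d) (q ^ d) k ^ 6)
      * q ^ ((2 * (d : ℤ) - 3 * r) * k)

/-- The `q`-harmonic sum `∑_{j=1}^{k} (q^(dj) / [dj]^2 + q^(dj-d+r) / [dj-d+r]^2)`. -/
def innerSum (d : ℕ) (r : ℤ) (k : ℕ) : RatFunc ℚ :=
  ∑ j ∈ Icc 1 k,
    (q ^ ((d : ℤ) * j) / qInt (d * j) ^ 2
      + q ^ ((d : ℤ) * j - d + r) / qInt (d * j - d + r) ^ 2)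

theorem one_sub_q_ne_zero : (1 - q : RatFunc ℚ) ≠ 0 := by
  intro h
  have h1 : algebraMap (Polynomial ℚ) (RatFunc ℚ) (1 - Polynomial.X) = 0 := by
    rw [map_sub, map_one, RatFunc.algebraMap_X]; exact h
  have h2 := RatFunc.algebraMap_injective ℚ (h1.trans (map_zero _).symm)
  have h3 := congrArg (Polynomial.eval 0) h2
  simp at h3

/-- The polynomial `q`-integer agrees with the rational-function one. -/
theorem algebraMap_qIntPoly (n : ℕ) :
    algebraMap (Polynomial ℚ) (RatFunc ℚ) (qIntPoly n) = qInt n := by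
  rw [qInt, eq_div_iff one_sub_q_ne_zero, qIntPoly, map_sum]
  simp only [map_pow, RatFunc.algebraMap_X, zpow_natCast]
  exact geom_sum_mul_neg _ _

theorem mul_topIndex {n d : ℕ} {r : ℤ} (hd : 3 ≤ d) (hnd : (d : ℤ) ≤ n + r) (hr : r = 1 ∨ r = -1)
    (hmod : (n : ℤ) ≡ -r [ZMOD d]) :
    (d : ℤ) * (topIndex n d r : ℤ) = (d : ℤ) * n - n - r := by
  obtain ⟨c, hc⟩ := hmod.dvd
  have hd0 : (0 : ℤ) < d := by exact_mod_cast (by omega : 0 < d)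
  have h1 : (d : ℤ) * n - n - r = d * (n + c) := by linarith
  have h2 : (0 : ℤ) ≤ d * (n + c) := by
    rw [← h1]
    have : (3 : ℤ) ≤ d := by exact_mod_cast hd
    rcases hr with rfl | rfl <;> nlinarith
  have h3 : (0 : ℤ) ≤ n + c := nonneg_of_mul_nonneg_right h2 hd0
  rw [topIndex, h1, Int.mul_ediv_cancel_left _ hd0.ne', Int.toNat_of_nonneg h3]

end QSeries

end

open QSeries

/-! Put a = q^r, p = q^d and u = a p^N = q^(dn-n). Up to the factor 1/(1-q), the left side is a
very-well-poised series with terms `vwpTerm a p k`. The modulus is the product of Φ_n^6 and the Φ_m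
with m ∣ n, 1 < m < n, and these are pairwise coprime. So it suffices to bound the valuation of the
difference at each Φ_m, and 1-q is a unit there.

At Φ_n the element u is a one-unit; write γ for the size of the uniformizer. Group the six ratios of
each term into two symmetric pairs with parameters x and y (`pairRatio`), one deformable last ratio,
and one ratio kept fixed. Call the sum F(x,y), with the last ratio undeformed. Then F(1,1) = 2F(u,1)
- F(u,u) + (second difference in x and y). Setting x = u makes the series terminate, since a/u =
p^(-N). Watson's transformation then evaluates 2F(u,1) - F(u,u), which is the right side modulo γ^6
(`val_balanced_comparison`).

The second difference is split by deforming the last ratio to u⁻¹. At u⁻¹ Watson applies again and x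
and y separate: the coefficients have order 2 and each difference has order 2, which gives 6
(`val_double_difference`). The remaining triple difference is visibly of order 2+2+1, and its
leading coefficient gains the missing order (`val_triple_difference`): modulo γ it is a series at a
= p^(-N) with palindromic weights, which vanishes because its terms are antisymmetric under k ↦ N-k
(`sum_vwpTerm_mul_eq_zero`).

At Φ_m with m < n both sides vanish separately. On the left, blocks of length m reduce to the same
antisymmetric sums. On the right, 1-u supplies Φ_m, and counting cyclotomic factors shows that the
rest is integral. -/

namespace QSeries

/-! ### Saalschütz, Bailey's lemma and Watson's transformation over a field. -/

section Watson

variable {K : Type*} [Field K]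

/-- The `q`-shifted factorial `(a; p)_k` over an arbitrary field. -/
def poch (a p : K) (k : ℕ) : K := ∏ i ∈ range k, (1 - a * p ^ i)

@[simp] theorem poch_zero (a p : K) : poch a p 0 = 1 := by simp [poch]

theorem poch_succ (a p : K) (k : ℕ) : poch a p (k + 1) = poch a p k * (1 - a * p ^ k) := by
  simp [poch, prod_range_succ]

theorem poch_add (a p : K) (k l : ℕ) :
    poch a p (k + l) = poch a p k * poch (a * p ^ k) p l := by
  simp only [poch, prod_range_add]
  congr 1
  exact prod_congr rfl fun i _ => by rw [pow_add, mul_assoc]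

theorem poch_ne_zero {a p : K} {k : ℕ} (h : ∀ i < k, 1 - a * p ^ i ≠ 0) : poch a p k ≠ 0 :=
  prod_ne_zero_iff.2 fun i hi => h i (mem_range.1 hi)

theorem poch_self_ne_zero {p : K} {k : ℕ} (h : ∀ i < k, 1 - p ^ (i + 1) ≠ 0) :
    poch p p k ≠ 0 :=
  poch_ne_zero fun i hi => by rw [← pow_succ']; exact h i hi

/-- The reversal of a `q`-shifted factorial. -/
theorem poch_reverse {p : K} (hp : p ≠ 0) :
    ∀ (k : ℕ) (x y : K), x * y * p ^ k = p →
      poch x p k = (-x) ^ k * p ^ (k.choose 2) * poch y p k := by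
  intro k x y h
  simp only [poch]
  rw [← prod_range_reflect (fun i => 1 - y * p ^ i)]
  have : (-x) ^ k * p ^ (k.choose 2) = ∏ i ∈ range k, (-x * p ^ i) := by
    rw [prod_mul_distrib, prod_const, card_range, prod_pow_eq_pow_sum, sum_range_id,
      Nat.choose_two_right]
  rw [this, ← prod_mul_distrib]
  refine prod_congr rfl fun i hi => ?_
  have hi := mem_range.1 hi
  obtain ⟨l, rfl⟩ : ∃ l, k = i + 1 + l := ⟨k - (i + 1), by omega⟩
  have e : i + 1 + l - 1 - i = l := by omega
  rw [e]
  have h2 : x * y * p ^ (i + l) = 1 := by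
    apply mul_right_cancel₀ hp
    rw [one_mul, mul_assoc, ← pow_succ, show i + l + 1 = i + 1 + l by omega, h]
  rw [pow_add] at h2
  linear_combination -h2

/-- A Wilf–Zeilberger certificate: the right side has the form G(m+1) - G(m), so the recurrence in L
= m + l telescopes over m. The factor 1 - p^m kills G(0). -/
theorem saalschutz_step (A B X p : K) (m l : ℕ) (hp : p ≠ 0)
    (h1 : ∀ i ≤ m + l, 1 - p ^ (i + 1) ≠ 0) (h2 : ∀ i ≤ m + l, 1 - A * B * X * p ^ i ≠ 0) :
    (1 - p ^ (m + l + 1)) * (1 - A * B * X * p ^ (m + l)) *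
        (poch A p m * poch B p m * X ^ m * poch X p (l + 1) /
          (poch p p m * poch p p (l + 1) * poch (A * B * X) p m))
      - (1 - B * X * p ^ (m + l)) * (1 - A * X * p ^ (m + l)) *
        (poch A p m * poch B p m * X ^ m * poch X p l /
          (poch p p m * poch p p l * poch (A * B * X) p m))
      = - p ^ l * (1 - p ^ (m + 1)) * (1 - A * B * X * p ^ m) *
          (poch A p (m + 1) * poch B p (m + 1) * X ^ (m + 1) * poch X p l /
            (poch p p (m + 1) * poch p p l * poch (A * B * X) p (m + 1)))
        + p ^ (l + 1) * (1 - p ^ m) * (1 - A * B * X * p ^ m / p) *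
          (poch A p m * poch B p m * X ^ m * poch X p (l + 1) /
            (poch p p m * poch p p (l + 1) * poch (A * B * X) p m)) := by
  have a1 : poch p p m ≠ 0 := poch_self_ne_zero fun i hi => h1 i (by omega)
  have a2 : poch p p l ≠ 0 := poch_self_ne_zero fun i hi => h1 i (by omega)
  have a3 : poch (A * B * X) p m ≠ 0 := poch_ne_zero fun i hi => h2 i (by omega)
  have a4 := h1 m (by omega)
  have a5 := h1 l (by omega)
  have a6 := h2 m (by omega)
  simp only [poch_succ]
  rw [pow_succ' p m] at *
  rw [pow_succ' p l] at *
  rw [pow_succ' p (m + l), pow_add p m l]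
  have a7 : p ^ m ≠ 0 := pow_ne_zero _ hp
  have a8 : p ^ l ≠ 0 := pow_ne_zero _ hp
  generalize poch p p m = x1 at *
  generalize poch p p l = x2 at *
  generalize poch (A * B * X) p m = x3 at *
  generalize poch A p m = y1 at *
  generalize poch B p m = y2 at *
  generalize poch X p l = y3 at *
  generalize p ^ m = s at *
  generalize p ^ l = t at *
  rw [pow_succ]
  generalize X ^ m = z at *
  generalize hw : 1 - A * B * X * s = w at *
  field_simp
  ring

/-- The terminating `q`-Pfaff–Saalschütz sum, in symmetric form. -/
theorem saalschutz (A B X p : K) (hp : p ≠ 0) (L : ℕ) (h1 : ∀ i < L, 1 - p ^ (i + 1) ≠ 0)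
    (h2 : ∀ i < L, 1 - A * B * X * p ^ i ≠ 0) :
    ∑ m ∈ range (L + 1), poch A p m * poch B p m * X ^ m * poch X p (L - m) /
        (poch p p m * poch p p (L - m) * poch (A * B * X) p m)
      = poch (A * X) p L * poch (B * X) p L / (poch p p L * poch (A * B * X) p L) := by
  induction L with
  | zero => simp
  | succ L ih =>
    specialize ih (fun i hi => h1 i (by omega)) (fun i hi => h2 i (by omega))
    have key : ∀ j ≤ L, ∑ m ∈ range (j + 1),
        ((1 - p ^ (L + 1)) * (1 - A * B * X * p ^ L) *
            (poch A p m * poch B p m * X ^ m * poch X p (L + 1 - m) /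
              (poch p p m * poch p p (L + 1 - m) * poch (A * B * X) p m))
          - (1 - B * X * p ^ L) * (1 - A * X * p ^ L) *
            (poch A p m * poch B p m * X ^ m * poch X p (L - m) /
              (poch p p m * poch p p (L - m) * poch (A * B * X) p m)))
        = - p ^ (L - j) * (1 - p ^ (j + 1)) * (1 - A * B * X * p ^ j) *
          (poch A p (j + 1) * poch B p (j + 1) * X ^ (j + 1) * poch X p (L - j) /
            (poch p p (j + 1) * poch p p (L - j) * poch (A * B * X) p (j + 1))) := by
      intro j hj
      induction j with
      | zero =>
        rw [sum_range_one]
        have := saalschutz_step A B X p 0 L hp (fun i hi => h1 i (by omega))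
          (fun i hi => h2 i (by omega))
        simpa using this
      | succ j ihj =>
        rw [sum_range_succ, ihj (by omega)]
        obtain ⟨l, rfl⟩ : ∃ l, L = j + 1 + l := ⟨L - (j + 1), by omega⟩
        have := saalschutz_step A B X p (j + 1) l hp (fun i hi => h1 i (by omega))
          (fun i hi => h2 i (by omega))
        rw [show j + 1 + l + 1 - (j + 1) = l + 1 by omega, show j + 1 + l - (j + 1) = l by omega,
          show j + 1 + l - j = l + 1 by omega, this, pow_succ p j]
        field_simp
        ring
    have k := key L le_rfl
    rw [sum_sub_distrib, ← mul_sum, ← mul_sum, ih] at k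
    -- The term m = L+1 is added by hand: there the truncated L - m would give a spurious nonzero
    -- summand for L.
    rw [sum_range_succ]
    simp only [Nat.sub_self, poch_zero, pow_zero] at k ⊢
    have a1 := h1 L (by omega)
    have a2 := h2 L (by omega)
    have a3 : poch p p L ≠ 0 := poch_self_ne_zero fun i hi => h1 i (by omega)
    have a4 : poch (A * B * X) p L ≠ 0 := poch_ne_zero fun i hi => h2 i (by omega)
    have e : (1 - p ^ (L + 1)) * (1 - A * B * X * p ^ L) ≠ 0 := mul_ne_zero a1 a2
    apply mul_left_cancel₀ e
    rw [mul_add]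
    simp only [poch_succ] at k ⊢
    rw [← sub_eq_zero] at k ⊢
    rw [← k, ← pow_succ' p L]
    field_simp
    ring

/-- The terminating form of Bailey's lemma. -/
theorem bailey_lemma (a p ρ σ X : K) (hX : ρ * σ * X = a * p) (hp : p ≠ 0) (N : ℕ) (α β : ℕ → K)
    (hβ : ∀ n ≤ N, β n = ∑ r ∈ range (n + 1), α r / (poch p p (n - r) * poch (a * p) p (n + r)))
    (h1 : ∀ i < N, 1 - p ^ (i + 1) ≠ 0) (h2 : ∀ i < 2 * N, 1 - a * p * p ^ i ≠ 0)
    (h3 : ∀ i < N, 1 - ρ * X * p ^ i ≠ 0) (h4 : ∀ i < N, 1 - σ * X * p ^ i ≠ 0) :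
    ∑ n ∈ range (N + 1), poch ρ p n * poch σ p n * X ^ n * poch X p (N - n) / poch p p (N - n) * β n
      = poch (ρ * X) p N * poch (σ * X) p N *
        ∑ r ∈ range (N + 1), poch ρ p r * poch σ p r * X ^ r * α r /
          (poch (ρ * X) p r * poch (σ * X) p r) / (poch p p (N - r) * poch (a * p) p (N + r)) := by
  have e1 : ∀ n ∈ range (N + 1),
      poch ρ p n * poch σ p n * X ^ n * poch X p (N - n) / poch p p (N - n) * β n =
        ∑ r ∈ range (n + 1), poch ρ p n * poch σ p n * X ^ n * poch X p (N - n) /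
          poch p p (N - n) * (α r / (poch p p (n - r) * poch (a * p) p (n + r))) := by
    intro n hn
    rw [hβ n (by simpa [Nat.lt_succ_iff] using hn), mul_sum]
  rw [sum_congr rfl e1, mul_sum]
  rw [sum_comm' (t' := range (N + 1)) (s' := fun r => Ico r (N + 1))
    (by intro x y; simp only [mem_range, mem_Ico]; omega)]
  refine sum_congr rfl fun r hr => ?_
  have hr : r ≤ N := by simpa [Nat.lt_succ_iff] using hr
  obtain ⟨L, rfl⟩ : ∃ L, N = r + L := ⟨N - r, by omega⟩
  rw [sum_Ico_eq_sum_range, show r + L + 1 - r = L + 1 by omega]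
  have hC : ρ * p ^ r * (σ * p ^ r) * X = a * p * p ^ (r + r) := by
    rw [pow_add]; linear_combination (p ^ r * p ^ r) * hX
  have h2' : ∀ i < L, 1 - ρ * p ^ r * (σ * p ^ r) * X * p ^ i ≠ 0 := fun i hi => by
    rw [hC, mul_assoc, ← pow_add]; exact h2 _ (by omega)
  -- With the sums exchanged and n = r + m, the inner sum is a Saalschütz sum with ρ and σ shifted
  -- by p^r.
  have S := saalschutz (ρ * p ^ r) (σ * p ^ r) X p hp L (fun i hi => h1 i (by omega)) h2'
  rw [hC] at S
  have c1 : poch (ρ * X) p r ≠ 0 := poch_ne_zero fun i hi => h3 i (by omega)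
  have c2 : poch (σ * X) p r ≠ 0 := poch_ne_zero fun i hi => h4 i (by omega)
  have c3 : poch (a * p) p (r + r) ≠ 0 := poch_ne_zero fun i hi => h2 i (by omega)
  have c4 : poch p p L ≠ 0 := poch_self_ne_zero fun i hi => h1 i (by omega)
  have c5 : poch (a * p * p ^ (r + r)) p L ≠ 0 := poch_ne_zero fun i hi => by
    rw [mul_assoc, ← pow_add]; exact h2 _ (by omega)
  calc _ = ∑ m ∈ range (L + 1), (poch ρ p r * poch σ p r * X ^ r * α r / poch (a * p) p (r + r)) *
        (poch (ρ * p ^ r) p m * poch (σ * p ^ r) p m * X ^ m * poch X p (L - m) /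
        (poch p p m * poch p p (L - m) * poch (a * p * p ^ (r + r)) p m)) := by
        refine sum_congr rfl fun m hm => ?_
        have hm : m ≤ L := by simpa [Nat.lt_succ_iff] using hm
        rw [show r + L - (r + m) = L - m by omega, show r + m - r = m by omega,
          show r + m + r = (r + r) + m by omega, poch_add ρ, poch_add σ, poch_add (a * p),
          pow_add]
        have d1 : poch p p m ≠ 0 := poch_self_ne_zero fun i hi => h1 i (by omega)
        have d2 : poch p p (L - m) ≠ 0 := poch_self_ne_zero fun i hi => h1 i (by omega)
        have d3 : poch (a * p * p ^ (r + r)) p m ≠ 0 := poch_ne_zero fun i hi => by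
          rw [mul_assoc, ← pow_add]; exact h2 _ (by omega)
        field_simp
    _ = _ := by
        rw [← mul_sum, S, show r + L - r = L by omega, show r + L + r = (r + r) + L by omega,
          poch_add (ρ * X), poch_add (σ * X), poch_add (a * p) p (r + r),
          show ρ * p ^ r * X = ρ * X * p ^ r by ring, show σ * p ^ r * X = σ * X * p ^ r by ring]
        generalize poch (ρ * X) p r = y1 at *
        generalize poch (σ * X) p r = y2 at *
        field_simp

/-- The `α`-sequence of the unit Bailey pair. -/
def unitAlpha (a p : K) (r : ℕ) : K :=
  (1 - a * p ^ (2 * r)) / (1 - a) * poch a p r / poch p p r * ((-1) ^ r * p ^ r.choose 2)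

theorem poch_mul_one_sub (a p : K) (k : ℕ) :
    (1 - a) * poch (a * p) p k = poch a p k * (1 - a * p ^ k) := by
  rw [← poch_succ, add_comm, poch_add]
  simp [poch]

/-- Closed form of the telescoping partial sums. It stops at R = n because the complete sum is zero,
whereas the truncated n - R would still give a formula at R = n+1. -/
theorem unitAlpha_partial_sum (a p : K) (n : ℕ) (ha : 1 - a ≠ 0)
    (h1 : ∀ i ≤ n, 1 - p ^ (i + 1) ≠ 0) (h2 : ∀ i < 2 * (n + 1), 1 - a * p * p ^ i ≠ 0) (R : ℕ)
    (hR : R ≤ n) :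
    ∑ r ∈ range (R + 1), unitAlpha a p r / (poch p p (n + 1 - r) * poch (a * p) p (n + 1 + r))
      = (-1) ^ R * p ^ (R + 1).choose 2 * poch (a * p) p R /
        (poch p p R * poch p p (n - R) * poch (a * p) p (n + 1 + R) * (1 - p ^ (n + 1))) := by
  induction R with
  | zero =>
    simp [unitAlpha, poch_succ, ← pow_succ', div_self ha]
    ring
  | succ R ih =>
    rw [sum_range_succ, ih (by omega)]
    obtain ⟨l, rfl⟩ : ∃ l, n = R + 1 + l := ⟨n - (R + 1), by omega⟩
    rw [show R + 1 + l - R = l + 1 by omega, show R + 1 + l + 1 - (R + 1) = l + 1 by omega,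
      show R + 1 + l - (R + 1) = l by omega, unitAlpha]
    have e : poch a p (R + 1) = (1 - a) * poch (a * p) p R := by
      rw [poch_mul_one_sub, poch_succ]
    rw [e, show R + 1 + l + 1 + (R + 1) = (R + 1 + l + 1 + R) + 1 by ring, poch_succ (a * p) p (_ + R),
      poch_succ (a * p) p R, poch_succ p p l, poch_succ p p R,
      show (R + 1 + 1).choose 2 = (R + 1).choose 2 + (R + 1) by
        rw [Nat.choose_succ_succ' (R + 1) 1]; simp [add_comm]]
    have d1 : poch p p R ≠ 0 := poch_self_ne_zero fun i hi => h1 i (by omega)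
    have d2 : poch p p l ≠ 0 := poch_self_ne_zero fun i hi => h1 i (by omega)
    have d3 : poch (a * p) p (R + 1 + l + 1 + R) ≠ 0 := poch_ne_zero fun i hi => h2 _ (by omega)
    have d4 := h1 R (by omega)
    have d5 := h1 l (by omega)
    have d6 := h1 (R + 1 + l) (by omega)
    have d7 := h2 (R + 1 + l + 1 + R) (by omega)
    rw [← pow_succ' p R, ← pow_succ' p l]
    generalize poch p p R = x1 at *
    generalize poch p p l = x2 at *
    generalize poch (a * p) p (R + 1 + l + 1 + R) = x3 at *
    generalize poch (a * p) p R = x4 at *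
    rw [show a * p * p ^ (R + 1 + l + 1 + R) = a * p ^ (2 * R + l + 3) by ring] at *
    rw [show 2 * (R + 1) = 2 * R + 2 by ring, pow_succ (-1 : K) R]
    rw [pow_add p ((R + 1).choose 2)]
    generalize p ^ (R + 1).choose 2 = c at *
    generalize (-1 : K) ^ R = sg at *
    have g1 : p ^ (2 * R + 2) = p ^ (R + 1) * p ^ (R + 1) := by ring
    have g2 : p ^ (2 * R + l + 3) = p ^ (R + 1) * p ^ (R + 1) * p ^ (l + 1) := by ring
    have g3 : p ^ (R + 1 + l + 1) = p ^ (R + 1) * p ^ (l + 1) := by ring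
    have g5 : a * p * p ^ R = a * p ^ (R + 1) := by ring
    rw [g5, g1]
    rw [g2] at d7 ⊢
    rw [g3] at d6 ⊢
    clear g1 g2 g3 g5 ih e h1 h2 hR
    generalize p ^ (R + 1) = s at *
    generalize p ^ (l + 1) = t at *
    generalize hw1 : 1 - s * t = w1 at *
    generalize hw2 : 1 - a * (s * s * t) = w2 at *
    generalize hw3 : 1 - s = w3 at *
    generalize hw4 : 1 - t = w4 at *
    generalize hw5 : 1 - a = w5 at *
    field_simp
    subst hw1 hw2 hw3 hw4 hw5
    ring

/-- The unit Bailey pair. -/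
theorem unitAlpha_sum (a p : K) (N : ℕ) (ha : 1 - a ≠ 0)
    (h1 : ∀ i < N, 1 - p ^ (i + 1) ≠ 0) (h2 : ∀ i < 2 * N, 1 - a * p * p ^ i ≠ 0) :
    ∑ r ∈ range (N + 1), unitAlpha a p r / (poch p p (N - r) * poch (a * p) p (N + r))
      = if N = 0 then 1 else 0 := by
  cases N with
  | zero => simp [unitAlpha, div_self ha]
  | succ n =>
    rw [sum_range_succ, unitAlpha_partial_sum a p n ha (fun i hi => h1 i (by omega)) h2 n le_rfl]
    have e : poch a p (n + 1) = (1 - a) * poch (a * p) p n := by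
      rw [poch_mul_one_sub, poch_succ]
    simp only [unitAlpha, e, Nat.sub_self, poch_zero, one_mul, mul_one]
    rw [show n + 1 + (n + 1) = (n + 1 + n) + 1 by ring, poch_succ (a * p) p (n + 1 + n),
      poch_succ p p n]
    have d1 : poch p p n ≠ 0 := poch_self_ne_zero fun i hi => h1 i (by omega)
    have d3 : poch (a * p) p (n + 1 + n) ≠ 0 := poch_ne_zero fun i hi => h2 _ (by omega)
    have d4 := h1 n (by omega)
    have d7 := h2 (n + 1 + n) (by omega)
    rw [← pow_succ' p n]
    rw [show a * p * p ^ (n + 1 + n) = a * p ^ (2 * (n + 1)) by ring] at *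
    generalize hw1 : 1 - a * p ^ (2 * (n + 1)) = w1 at *
    generalize hw2 : 1 - a = w2 at *
    generalize hw3 : 1 - p ^ (n + 1) = w3 at *
    rw [pow_succ (-1 : K) n, if_neg (by omega)]
    generalize poch (a * p) p n = x4 at *
    generalize poch (a * p) p (n + 1 + n) = x5 at *
    generalize poch p p n = x6 at *
    field_simp
    ring

/-- Watson's transformation of a terminating very-well-poised `₈φ₇` series into a balanced
`₄φ₃` series. -/
theorem watson (a p b c d e X Y : K) (N : ℕ) (hX : b * c * X = a * p) (hY : d * e * Y = a * p)
    (hp : p ≠ 0) (ha : 1 - a ≠ 0)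
    (h1 : ∀ i < N, 1 - p ^ (i + 1) ≠ 0) (h2 : ∀ i < 2 * N, 1 - a * p * p ^ i ≠ 0)
    (hb : ∀ i < N, 1 - b * X * p ^ i ≠ 0) (hc : ∀ i < N, 1 - c * X * p ^ i ≠ 0)
    (hd : ∀ i < N, 1 - d * Y * p ^ i ≠ 0) (he : ∀ i < N, 1 - e * Y * p ^ i ≠ 0) :
    ∑ n ∈ range (N + 1), poch d p n * poch e p n * Y ^ n * poch Y p (N - n) / poch p p (N - n) *
        (poch X p n / (poch p p n * poch (b * X) p n * poch (c * X) p n))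
      = poch (d * Y) p N * poch (e * Y) p N *
        ∑ r ∈ range (N + 1), poch b p r * poch c p r * poch d p r * poch e p r *
          (X * Y) ^ r * unitAlpha a p r /
          (poch (b * X) p r * poch (c * X) p r * poch (d * Y) p r * poch (e * Y) p r) /
          (poch p p (N - r) * poch (a * p) p (N + r)) := by
  have B1 : ∀ n ≤ N, poch X p n / (poch p p n * poch (b * X) p n * poch (c * X) p n) =
      ∑ r ∈ range (n + 1), (poch b p r * poch c p r * X ^ r * unitAlpha a p r /
          (poch (b * X) p r * poch (c * X) p r)) / (poch p p (n - r) * poch (a * p) p (n + r)) := by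
    intro n hn
    have B := bailey_lemma a p b c X hX hp n (unitAlpha a p) (fun n => if n = 0 then 1 else 0)
      (fun m hm => (unitAlpha_sum a p m ha (fun i hi => h1 i (by omega))
        (fun i hi => h2 i (by omega))).symm)
      (fun i hi => h1 i (by omega)) (fun i hi => h2 i (by omega))
      (fun i hi => hb i (by omega)) (fun i hi => hc i (by omega))
    have c1 : poch (b * X) p n ≠ 0 := poch_ne_zero fun i hi => hb i (by omega)
    have c2 : poch (c * X) p n ≠ 0 := poch_ne_zero fun i hi => hc i (by omega)
    apply mul_left_cancel₀ (mul_ne_zero c1 c2)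
    -- Since β is the unit sequence, only the index 0 survives on the β-side of the first
    -- application of Bailey's lemma.
    rw [← B, sum_eq_single 0 (by intro b _ hb; simp [hb]) (by simp)]
    simp only [poch_zero, pow_zero, if_true, Nat.sub_zero]
    generalize poch (b * X) p n = x at *
    generalize poch (c * X) p n = y at *
    field_simp
  rw [bailey_lemma a p d e Y hY hp N _ _ B1 h1 h2 hd he]
  congr 1
  refine sum_congr rfl fun r _ => ?_
  rw [mul_pow]
  simp only [div_eq_mul_inv, mul_inv]
  ring

end Watson
end QSeries

namespace QSeries

/-! ### Antisymmetry of the very-well-poised terms at a = p^(-N). -/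

section Antisymmetry

variable {K : Type*} [Field K]

theorem two_mul_choose_two_add (k : ℕ) : 2 * k.choose 2 + k = k * k := by
  induction k with
  | zero => simp
  | succ k ih =>
    rw [Nat.choose_succ_succ' k 1, Nat.choose_one_right]
    linarith

/-- Here b = p^(-(k+l)); reversing the last k factors of (p;p)_(k+l) turns them into (b;p)_k. -/
theorem poch_inv_pow {p b : K} {k l : ℕ} (hp : p ≠ 0) (hb : b * p ^ (k + l) = 1) :
    poch p p (k + l) * ((-1) ^ k * p ^ k.choose 2) = poch p p l * poch b p k * (p ^ (k + l)) ^ k := by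
  rw [add_comm k l, poch_add, poch_reverse hp k (p * p ^ l) b
    (by rw [add_comm, pow_add] at hb; linear_combination p * hb)]
  have h2 : p ^ k.choose 2 * p ^ k.choose 2 * p ^ k = p ^ (k * k) := by
    rw [← pow_add, ← pow_add]
    rw [← two_mul_choose_two_add k, two_mul]
  rw [neg_pow, show (p * p ^ l) ^ k = p ^ k * p ^ (l * k) by rw [mul_pow, pow_mul],
    show (p ^ (l + k)) ^ k = p ^ (k * k) * p ^ (l * k) by
      rw [← pow_mul, ← pow_add]; ring_nf, ← h2]
  have : ((-1 : K) ^ k) * (-1) ^ k = 1 := by rw [← mul_pow]; simp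
  linear_combination (poch p p l * p ^ k * p ^ (l * k) * p ^ k.choose 2 * p ^ k.choose 2 *
    poch b p k) * this

/-- The terms of the very-well-poised series with all parameters equal to `a`. -/
def vwpTerm (a p : K) (k : ℕ) : K :=
  (1 - a * p ^ (2 * k)) * (poch a p k / poch p p k) ^ 6 * (p ^ 2 / a ^ 3) ^ k

/-- Writing (b;p)_k/(p;p)_k as a q-binomial coefficient exposes the antisymmetry: everything is
symmetric in k and l except 1/p^k - 1/p^l. The even power 6 removes the sign (-1)^k. -/
theorem vwpTerm_of_mul_pow_eq_one {p b : K} {k l : ℕ} (hp : p ≠ 0) (hb : b * p ^ (k + l) = 1)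
    (hl : poch p p l ≠ 0) (hk : poch p p k ≠ 0) :
    vwpTerm b p k = (poch p p (k + l) / (poch p p k * poch p p l)) ^ 6 *
      (1 / p ^ k - 1 / p ^ l) / p ^ (3 * (k * l)) := by
  have e := poch_inv_pow hp hb
  have hs : ((-1 : K) ^ k) ^ 6 = 1 := by rw [← pow_mul, mul_comm, pow_mul]; norm_num
  have hch := two_mul_choose_two_add k
  have e2 : poch b p k = poch p p (k + l) * ((-1) ^ k * p ^ k.choose 2) /
      (poch p p l * (p ^ (k + l)) ^ k) := by
    rw [e]; field_simp
  have hb' : b = 1 / p ^ (k + l) := by field_simp; exact hb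
  have e3 : (p ^ k.choose 2) ^ 6 * (p ^ k) ^ 3 = p ^ (3 * (k * k)) := by
    rw [← hch]; ring
  rw [vwpTerm, e2, hb']
  have e4 : (p ^ 2 / (1 / p ^ (k + l)) ^ 3) ^ k = (p ^ k) ^ 2 * p ^ (3 * (k * k)) * p ^ (3 * (k * l)) := by
    rw [one_div, inv_pow, div_inv_eq_mul]; ring
  have e5 : ((p ^ (k + l)) ^ k) ^ 6 = p ^ (3 * (k * k)) * p ^ (3 * (k * k)) * p ^ (3 * (k * l)) *
      p ^ (3 * (k * l)) := by ring
  rw [e4, div_div, div_pow, mul_pow, mul_pow, hs, mul_pow, mul_pow, e5, ← e3, div_pow, mul_pow,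
    pow_mul p 2 k, pow_right_comm, pow_add]
  have h1 : p ^ k ≠ 0 := pow_ne_zero _ hp
  have h2 : p ^ l ≠ 0 := pow_ne_zero _ hp
  have h3 : p ^ (3 * (k * l)) ≠ 0 := pow_ne_zero _ hp
  have h4 : p ^ k.choose 2 ≠ 0 := pow_ne_zero _ hp
  generalize p ^ k = s at *
  generalize p ^ l = t at *
  generalize p ^ (3 * (k * l)) = z at *
  generalize p ^ k.choose 2 = y at *
  field_simp

/-- A very-well-poised series with a palindromic weight vanishes when it is balanced
around its middle. -/
theorem sum_vwpTerm_mul_eq_zero [CharZero K] {p b : K} {N : ℕ} (hp : p ≠ 0) (hb : b * p ^ N = 1)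
    (h1 : ∀ i < N, 1 - p ^ (i + 1) ≠ 0) (φ : ℕ → K) (hφ : ∀ k ≤ N, φ (N - k) = φ k) :
    ∑ k ∈ range (N + 1), vwpTerm b p k * φ k = 0 := by
  have key : ∑ k ∈ range (N + 1), vwpTerm b p k * φ k =
      - ∑ k ∈ range (N + 1), vwpTerm b p k * φ k := by
    conv_lhs => rw [← sum_range_reflect]
    rw [← sum_neg_distrib]
    refine sum_congr rfl fun k hk => ?_
    have hk : k ≤ N := by simpa [Nat.lt_succ_iff] using hk
    rw [show N + 1 - 1 - k = N - k by omega, hφ k hk]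
    obtain ⟨l, rfl⟩ : ∃ l, N = k + l := ⟨N - k, by omega⟩
    have hk' : poch p p k ≠ 0 := poch_self_ne_zero fun i hi => h1 i (by omega)
    have hl' : poch p p l ≠ 0 := poch_self_ne_zero fun i hi => h1 i (by omega)
    rw [show k + l - k = l by omega, vwpTerm_of_mul_pow_eq_one hp hb hl' hk',
      vwpTerm_of_mul_pow_eq_one hp (add_comm k l ▸ hb) hk' hl', add_comm l k, mul_comm l k,
      mul_comm (poch p p l)]
    ring
  exact self_eq_neg.1 key

/-- With S(k) = φ(1) + ⋯ + φ(k), the right side is S(k) + S(N-k) - S(N), which is symmetric in k and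
N-k. -/
theorem palindromic_sum_sub_reflect (N : ℕ) (φ : ℕ → K) {k : ℕ} (hk : k ≤ N) :
    ∑ j ∈ range (N - k), (φ (j + 1) - φ (N - j)) = ∑ j ∈ range k, (φ (j + 1) - φ (N - j)) := by
  have h : ∀ k ≤ N, ∑ j ∈ range k, φ (N - j) =
      ∑ j ∈ range N, φ (j + 1) - ∑ j ∈ range (N - k), φ (j + 1) := by
    intro k hk
    obtain ⟨l, rfl⟩ : ∃ l, N = l + k := ⟨N - k, by omega⟩
    rw [sum_range_add, show l + k - k = l by omega, add_sub_cancel_left, ← sum_range_reflect]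
    refine sum_congr rfl fun j hj => ?_
    have := mem_range.1 hj
    congr 1; omega
  rw [sum_sub_distrib, sum_sub_distrib, h k hk, h (N - k) (by omega),
    show N - (N - k) = k by omega]
  ring

end Antisymmetry

/-! ### Congruences and first-order expansions for a valuation. -/

section Valuation

variable {K : Type*} [Field K] {Γ : Type*} [LinearOrderedCommGroupWithZero Γ] (v : Valuation K Γ)

/-- Congruence of integral elements with respect to a valuation. -/
structure ModEq (γ : Γ) (x y : K) : Prop where
  left : v x ≤ 1
  right : v y ≤ 1
  sub : v (x - y) ≤ γ

variable {v} {γ : Γ} {x y z w : K}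

theorem ModEq.refl (hx : v x ≤ 1) : ModEq v γ x x := ⟨hx, hx, by simp⟩

theorem ModEq.mul (h : ModEq v γ x y) (h' : ModEq v γ z w) : ModEq v γ (x * z) (y * w) := by
  refine ⟨?_, ?_, ?_⟩
  · rw [map_mul]; exact mul_le_one' h.left h'.left
  · rw [map_mul]; exact mul_le_one' h.right h'.right
  · rw [show x * z - y * w = (x - y) * z + y * (z - w) by ring]
    refine v.map_add_le ?_ ?_
    · rw [map_mul]; exact mul_le_of_le_of_le_one h.sub h'.left
    · rw [map_mul]; exact mul_le_of_le_one_of_le h.right h'.sub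

theorem ModEq.sub' (h : ModEq v γ x y) (h' : ModEq v γ z w) : ModEq v γ (x - z) (y - w) := by
  refine ⟨v.map_sub_le h.left h'.left, v.map_sub_le h.right h'.right, ?_⟩
  rw [show x - z - (y - w) = (x - y) - (z - w) by ring]
  exact v.map_sub_le h.sub h'.sub

theorem ModEq.pow (h : ModEq v γ x y) (n : ℕ) : ModEq v γ (x ^ n) (y ^ n) := by
  induction n with
  | zero => simpa using ModEq.refl (by simp)
  | succ n ih => rw [pow_succ, pow_succ]; exact ih.mul h

theorem ModEq.sum {ι : Type*} {s : Finset ι} {f g : ι → K} (h : ∀ i ∈ s, ModEq v γ (f i) (g i)) :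
    ModEq v γ (∑ i ∈ s, f i) (∑ i ∈ s, g i) := by
  refine ⟨v.map_sum_le fun i hi => (h i hi).left, v.map_sum_le fun i hi => (h i hi).right, ?_⟩
  rw [← sum_sub_distrib]
  exact v.map_sum_le fun i hi => (h i hi).sub

theorem ModEq.prod {ι : Type*} {s : Finset ι} {f g : ι → K} (h : ∀ i ∈ s, ModEq v γ (f i) (g i)) :
    ModEq v γ (∏ i ∈ s, f i) (∏ i ∈ s, g i) := by
  classical
  induction s using Finset.induction_on with
  | empty => simpa using ModEq.refl (by simp)
  | insert a s ha ih =>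
    rw [prod_insert ha, prod_insert ha]
    exact (h a (by simp)).mul (ih fun i hi => h i (by simp [hi]))

theorem ModEq.inv (h : ModEq v γ x y) (hx : v x = 1) (hy : v y = 1) : ModEq v γ x⁻¹ y⁻¹ := by
  have hx0 : x ≠ 0 := fun h => by simp [h] at hx
  have hy0 : y ≠ 0 := fun h => by simp [h] at hy
  refine ⟨by simp [hx], by simp [hy], ?_⟩
  rw [show x⁻¹ - y⁻¹ = -(x⁻¹ * y⁻¹ * (x - y)) by field_simp; ring, Valuation.map_neg]
  simpa [hx, hy] using h.sub

theorem ModEq.poch {p : K} (h : ModEq v γ x y) (hp : v p ≤ 1) (k : ℕ) :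
    ModEq v γ (poch x p k) (poch y p k) :=
  ModEq.prod fun i _ => (ModEq.refl (by simp)).sub'
    (h.mul (ModEq.refl (by rw [map_pow]; exact pow_le_one' hp i)))

theorem valuation_poch_le_one {p : K} (hx : v x ≤ 1) (hp : v p ≤ 1) (k : ℕ) :
    v (QSeries.poch x p k) ≤ 1 :=
  ((ModEq.refl (γ := 0) hx).poch hp k).left

theorem valuation_poch_eq_one {p : K} {k : ℕ} (h : ∀ i < k, v (1 - x * p ^ i) = 1) :
    v (QSeries.poch x p k) = 1 := by
  rw [QSeries.poch, map_prod]
  exact prod_eq_one fun i hi => h i (mem_range.1 hi)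

theorem valuation_poch_le_of_factor {p : K} {k i : ℕ} (hx : v x ≤ 1) (hp : v p ≤ 1) (hi : i < k)
    (h : v (1 - x * p ^ i) ≤ γ) : v (QSeries.poch x p k) ≤ γ := by
  rw [QSeries.poch, ← mul_prod_erase _ _ (mem_range.2 hi), map_mul]
  refine mul_le_of_le_of_le_one h ?_
  rw [map_prod]
  refine prod_le_one' fun j _ => v.map_sub_le (by simp) ?_
  rw [map_mul, map_pow]
  exact mul_le_one' hx (pow_le_one' hp j)

theorem valuation_eq_one_of_sub_lt (h : v y = 1) (h' : v (x - y) < 1) : v x = 1 := by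
  rw [← h] at h' ⊢
  exact (v.map_eq_of_sub_lt h')

/-- `x = 1 + ε α` up to second order in `ε`. -/
structure FirstOrder (v : Valuation K Γ) (ε x α : K) : Prop where
  coeff : v α ≤ 1
  sub : v (x - 1 - ε * α) ≤ v ε ^ 2

variable {ε α β : K}

theorem FirstOrder.sub_one (h : FirstOrder v ε x α) (hε : v ε < 1) : v (x - 1) ≤ v ε := by
  rw [show x - 1 = (x - 1 - ε * α) + ε * α by ring]
  refine v.map_add_le (h.sub.trans ?_) ?_
  · rw [sq]; exact mul_le_of_le_one_left' hε.le
  · rw [map_mul]; exact mul_le_of_le_one_right' h.coeff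

theorem FirstOrder.val (h : FirstOrder v ε x α) (hε : v ε < 1) : v x = 1 :=
  valuation_eq_one_of_sub_lt (map_one v) ((h.sub_one hε).trans_lt hε)

theorem FirstOrder.mul (h : FirstOrder v ε x α) (h' : FirstOrder v ε y β) (hε : v ε < 1) :
    FirstOrder v ε (x * y) (α + β) := by
  refine ⟨v.map_add_le h.coeff h'.coeff, ?_⟩
  rw [show x * y - 1 - ε * (α + β) =
    (x - 1 - ε * α) * y + ((y - 1 - ε * β) + ε * α * (y - 1)) by ring]
  refine v.map_add_le ?_ (v.map_add_le h'.sub ?_)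
  · rw [map_mul, h'.val hε, mul_one]; exact h.sub
  · rw [map_mul, map_mul, sq]
    exact mul_le_mul' (mul_le_of_le_one_right' h.coeff) (h'.sub_one hε)

theorem FirstOrder.inv (h : FirstOrder v ε x α) (hε : v ε < 1) : FirstOrder v ε x⁻¹ (-α) := by
  have hx := h.val hε
  have hx0 : x ≠ 0 := fun h => by simp [h] at hx
  refine ⟨by simpa using h.coeff, ?_⟩
  rw [show x⁻¹ - 1 - ε * -α = x⁻¹ * (-(x - 1 - ε * α) + ε * α * (x - 1)) by field_simp; ring,
    map_mul, map_inv₀, hx, inv_one, one_mul]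
  refine v.map_add_le (by rw [Valuation.map_neg]; exact h.sub) ?_
  rw [map_mul, map_mul, sq]
  exact mul_le_mul' (mul_le_of_le_one_right' h.coeff) (h.sub_one hε)

theorem FirstOrder.prod {ι : Type*} {s : Finset ι} {f g : ι → K} (hε : v ε < 1)
    (h : ∀ i ∈ s, FirstOrder v ε (f i) (g i)) :
    FirstOrder v ε (∏ i ∈ s, f i) (∑ i ∈ s, g i) := by
  classical
  induction s using Finset.induction_on with
  | empty => exact ⟨by simp, by simp⟩
  | insert a s ha ih =>
    rw [prod_insert ha, sum_insert ha]
    exact (h a (by simp)).mul (ih fun i hi => h i (by simp [hi])) hε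

theorem FirstOrder.one_add (h : v α ≤ 1) : FirstOrder v ε (1 + ε * α) α :=
  ⟨h, by simp⟩

end Valuation
end QSeries

namespace QSeries

/-! ### Watson's transformation with terminating parameter a/u = p^(-N). -/

section SpecialWatson

variable {K : Type*} [Field K]

/-- The reversal of (p;p)_(N-r) and the tail of (ap;p)_(N+r) produce the parameter pair
(a/u;p)_r/(pu;p)_r. The prefactor contains 1-u because (ap;p)_(N+r) does once N ≥ 1. -/
theorem unitAlpha_div {a p u : K} {N r : ℕ} (hr : r ≤ N) (hu : a * p ^ N = u) (hu0 : u ≠ 0)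
    (hp : p ≠ 0) (ha : 1 - a ≠ 0) (h1 : ∀ i < N, 1 - p ^ (i + 1) ≠ 0)
    (h2 : ∀ i < 2 * N, 1 - a * p * p ^ i ≠ 0) :
    poch p p N * poch a p N * (1 - u) *
        (unitAlpha a p r / (poch p p (N - r) * poch (a * p) p (N + r))) =
      (1 - a * p ^ (2 * r)) * (poch a p r / poch p p r) *
        (poch (a / u) p r / poch (p * u) p r) * (p ^ N) ^ r := by
  obtain ⟨l, rfl⟩ : ∃ l, N = r + l := ⟨N - r, by omega⟩
  have e := poch_inv_pow (p := p) (b := a / u) (k := r) (l := l) hp (by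
    rw [div_mul_eq_mul_div, hu, div_self hu0])
  have e2 := poch_mul_one_sub a p (r + l)
  rw [hu] at e2
  rw [show r + l - r = l by omega, poch_add (a * p) p (r + l) r,
    show a * p * p ^ (r + l) = p * u by rw [← hu]; ring, unitAlpha]
  have d1 : poch p p r ≠ 0 := poch_self_ne_zero fun i hi => h1 i (by omega)
  have d2 : poch p p l ≠ 0 := poch_self_ne_zero fun i hi => h1 i (by omega)
  have d3 : poch (a * p) p (r + l) ≠ 0 := poch_ne_zero fun i hi => h2 i (by omega)
  have d4 : poch (p * u) p r ≠ 0 := poch_ne_zero fun i hi => by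
    have := h2 (r + l + i) (by omega)
    rwa [show p * u * p ^ i = a * p * p ^ (r + l + i) by rw [← hu]; ring]
  have d5 : p ^ (r + l) ≠ 0 := pow_ne_zero _ hp
  generalize (-1 : K) ^ r * p ^ r.choose 2 = s at *
  generalize p ^ (r + l) = t at *
  generalize poch p p (r + l) = x1 at *
  generalize poch p p r = x2 at *
  generalize poch p p l = x3 at *
  generalize poch (a * p) p (r + l) = x4 at *
  generalize poch (p * u) p r = x5 at *
  generalize poch (a / u) p r = x6 at *
  generalize poch a p (r + l) = x7 at *
  generalize 1 - a * p ^ (2 * r) = x8 at *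
  generalize hw : 1 - a = w at *
  field_simp
  linear_combination x8 * x7 * (1 - u) * poch a p r * e -
    x3 * x6 * t ^ r * x8 * poch a p r * e2

/-- Watson's transformation with the terminating parameter written as `a / u`, `u = a p^N`. -/
theorem watson_of_mul_pow (a p u b c d e X Y B C D E : K) (N : ℕ) (hX : b * c * X = a * p)
    (hY : d * e * Y = a * p) (hB : b * X = B) (hC : c * X = C) (hD : d * Y = D) (hE : e * Y = E)
    (hu : a * p ^ N = u) (hu0 : u ≠ 0) (hp : p ≠ 0) (ha : 1 - a ≠ 0)
    (h1 : ∀ i < N, 1 - p ^ (i + 1) ≠ 0) (h2 : ∀ i < 2 * N, 1 - a * p * p ^ i ≠ 0)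
    (hb : ∀ i < N, 1 - B * p ^ i ≠ 0) (hc : ∀ i < N, 1 - C * p ^ i ≠ 0)
    (hd : ∀ i < N, 1 - D * p ^ i ≠ 0) (he : ∀ i < N, 1 - E * p ^ i ≠ 0) :
    poch p p N * poch a p N * (1 - u) * ∑ n ∈ range (N + 1),
        poch d p n * poch e p n * Y ^ n * poch Y p (N - n) / poch p p (N - n) *
          (poch X p n / (poch p p n * poch B p n * poch C p n))
      = poch D p N * poch E p N *
        ∑ r ∈ range (N + 1), (1 - a * p ^ (2 * r)) * (poch a p r / poch p p r) *
          (poch (a / u) p r / poch (p * u) p r) *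
          (poch b p r * poch c p r / (poch B p r * poch C p r)) *
          (poch d p r * poch e p r / (poch D p r * poch E p r)) * (X * Y * p ^ N) ^ r := by
  subst hB hC hD hE
  rw [watson a p b c d e X Y N hX hY hp ha h1 h2 hb hc hd he, mul_left_comm]
  congr 1
  rw [mul_sum]
  refine sum_congr rfl fun r hr => ?_
  have := unitAlpha_div (by simpa [Nat.lt_succ_iff] using hr) hu hu0 hp ha h1 h2
  rw [mul_pow]
  calc _ = (poch b p r * poch c p r / (poch (b * X) p r * poch (c * X) p r)) *
          (poch d p r * poch e p r / (poch (d * Y) p r * poch (e * Y) p r)) * (X * Y) ^ r *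
          (poch p p N * poch a p N * (1 - u) *
            (unitAlpha a p r / (poch p p (N - r) * poch (a * p) p (N + r)))) := by
        simp only [div_eq_mul_inv, mul_inv]; ring
    _ = _ := by rw [this]; ring

/-- The reflection identity that brings the balanced series into its final shape. -/
theorem poch_reflect_prefactor {a p u : K} {N n : ℕ} (hn : n ≤ N) (hu : a * p ^ N = u)
    (hu0 : u ≠ 0) (ha0 : a ≠ 0) (hp : p ≠ 0) :
    poch a p N * (poch (p / (a * u)) p (N - n) * (p / (a * u)) ^ n) * poch p p N =
      (a ^ N)⁻¹ * poch (p / u) p N * poch p p (N - n) * poch (a ^ 2 * p ^ n) p (N - n) *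
        poch (a / u) p n * p ^ n := by
  obtain ⟨l, rfl⟩ : ∃ l, N = n + l := ⟨N - n, by omega⟩
  rw [show n + l - n = l by omega]
  have e := poch_inv_pow (p := p) (b := a / u) (k := n) (l := l) hp (by
    rw [div_mul_eq_mul_div, hu, div_self hu0])
  rw [poch_reverse hp (n + l) a (p / u) (by rw [mul_right_comm, hu]; field_simp),
    poch_reverse hp l (p / (a * u)) (a ^ 2 * p ^ n) (by
      rw [mul_assoc, mul_assoc (a ^ 2), ← pow_add]
      field_simp
      rw [hu])]
  have hY : a ^ 2 * (p / (a * u)) * p ^ (n + l) = p := by field_simp; exact hu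
  generalize p / (a * u) = Y at *
  have s1 : a ^ (n + l) * a ^ (n + l) * Y ^ (n + l) * p ^ ((n + l) * (n + l)) = p ^ (n + l) := by
    rw [pow_mul, ← mul_pow, ← mul_pow, ← mul_pow, ← sq, hY]
  have c1 := two_mul_choose_two_add (n + l)
  have c2 := two_mul_choose_two_add n
  have c3 := two_mul_choose_two_add l
  have s2 : p ^ ((n + l).choose 2) * p ^ l.choose 2 * (p ^ (n + l)) ^ n * p ^ (n + l) =
      p ^ n * p ^ n.choose 2 * p ^ ((n + l) * (n + l)) := by
    rw [← pow_mul, ← pow_add, ← pow_add, ← pow_add, ← pow_add, ← pow_add]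
    congr 1
    have : (n + l) * (n + l) = n * n + 2 * (n * l) + l * l := by ring
    have : (n + l) * n = n * n + n * l := by ring
    omega
  have s3 : ((-1 : K) ^ n) * (-1) ^ n = 1 := by rw [← mul_pow]; simp
  have s4 : ((-1 : K) ^ l) * (-1) ^ l = 1 := by rw [← mul_pow]; simp
  have hq : p ^ ((n + l) * (n + l)) ≠ 0 := pow_ne_zero _ hp
  have hq2 : (p ^ (n + l)) ^ n ≠ 0 := pow_ne_zero _ (pow_ne_zero _ hp)
  have ha2 : a ^ (n + l) ≠ 0 := pow_ne_zero _ ha0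
  apply mul_left_cancel₀ hq2
  apply mul_left_cancel₀ hq
  apply mul_left_cancel₀ ha2
  rw [neg_pow a, neg_pow Y, pow_add (-1 : K)]
  have e' : (p ^ (n + l)) ^ n * ((a ^ (n + l))⁻¹ * poch (p / u) p (n + l) * poch p p l *
      poch (a ^ 2 * p ^ n) p l * poch (a / u) p n * p ^ n) =
      (a ^ (n + l))⁻¹ * poch (p / u) p (n + l) * poch (a ^ 2 * p ^ n) p l * p ^ n *
        (poch p p (n + l) * ((-1) ^ n * p ^ n.choose 2)) := by
    rw [e]; ring
  rw [e']
  have hY' : Y ^ (n + l) = Y ^ n * Y ^ l := pow_add _ _ _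
  rw [hY'] at s1
  generalize a ^ (n + l) = A at *
  generalize p ^ ((n + l) * (n + l)) = Q at *
  generalize p ^ (n + l) = P at *
  generalize P ^ n = P2 at *
  generalize poch (p / u) p (n + l) = x1 at *
  generalize poch (a ^ 2 * p ^ n) p l = x2 at *
  generalize poch p p (n + l) = x3 at *
  generalize p ^ (n + l).choose 2 = z1 at *
  generalize p ^ l.choose 2 = z2 at *
  generalize p ^ n.choose 2 = z3 at *
  generalize p ^ n = z4 at *
  generalize (-1 : K) ^ n = sn at *
  generalize (-1 : K) ^ l = sl at *
  have e3 : A * (Q * (A⁻¹ * x1 * x2 * z4 * (x3 * (sn * z3)))) =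
      Q * (x1 * x2 * z4 * (x3 * (sn * z3))) := by field_simp
  rw [e3]
  linear_combination (sn * sl * sl * z1 * z2 * P2 * x1 * x2 * x3) * s1
    + sn * z1 * z2 * P2 * P * x1 * x2 * x3 * s4 + sn * x1 * x2 * x3 * s2

end SpecialWatson

/-! ### The local situation at Φ_n and the two terminating evaluations. -/

section Local

variable {K : Type*} [Field K] {Γ : Type*} [LinearOrderedCommGroupWithZero Γ]

/-- The local situation at a prime: `p` is a unit of large multiplicative order in the residue
field, and `u = a p^N` is a one-unit. -/
structure LocalData (v : Valuation K Γ) (γ : Γ) (a p u : K) (N : ℕ) : Prop where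
  top : a * p ^ N = u
  val_p : v p = 1
  lt_one : γ < 1
  near : v (1 - u) ≤ γ
  ne_one : u ≠ 1
  pos : 1 ≤ N
  val_P : ∀ i < N, v (1 - p ^ (i + 1)) = 1

end Local
end QSeries

namespace QSeries

section Local

variable {K : Type*} [Field K] {Γ : Type*} [LinearOrderedCommGroupWithZero Γ]

/-- The ratio of symmetric pairs of `q`-shifted factorials. -/
def pairRatio (a p x : K) (k : ℕ) : K :=
  poch (a * x) p k * poch (a / x) p k / (poch (p * x) p k * poch (p / x) p k)

/-- The part of a very-well-poised term that does not depend on the free parameters. -/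
def baseTerm (a p : K) (k : ℕ) : K :=
  (1 - a * p ^ (2 * k)) * (poch a p k / poch p p k) * (p ^ 2 / a ^ 3) ^ k

theorem pairRatio_one (a p : K) (k : ℕ) : pairRatio a p 1 k = (poch a p k / poch p p k) ^ 2 := by
  simp only [pairRatio, mul_one, div_one, sq, mul_div_mul_comm]

theorem vwpTerm_eq (a p : K) (k : ℕ) :
    vwpTerm a p k = baseTerm a p k * pairRatio a p 1 k ^ 2 * (poch a p k / poch p p k) := by
  rw [pairRatio_one, vwpTerm, baseTerm]; ring

/-- The coefficients of the balanced series at the parameter `u`. -/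
def balancedCoeff (a p u : K) (N n : ℕ) : K :=
  (1 - u) * (a ^ N)⁻¹ / poch p p N * poch (a ^ 2 * p ^ n) p (N - n) * poch a p n *
    poch (p / a) p n * p ^ n / poch p p n

/-- The coefficients of the balanced series at the parameter `u⁻¹`. -/
def balancedCoeff' (a p u : K) (N n : ℕ) : K :=
  poch p p N * poch a p N * (1 - u) * (p / a) ^ n * poch (p / a) p (N - n) * poch (p / a) p n /
    (poch p p (N - n) * poch p p n)

namespace LocalData

variable {v : Valuation K Γ} {γ : Γ} {a p u y x : K} {N : ℕ}

theorem ne_zero_of_val (hx : v x = 1) : x ≠ 0 := fun h0 => by simp [h0] at hx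

theorem near_one : v (1 - (1 : K)) ≤ γ := by simp

variable (h : LocalData v γ a p u N)
include h

theorem val_of_near (hy : v (1 - y) ≤ γ) : v y = 1 :=
  valuation_eq_one_of_sub_lt (map_one v) (by rw [v.map_sub_swap]; exact hy.trans_lt h.lt_one)

theorem near_mul (hx : v (1 - x) ≤ γ) (hy : v (1 - y) ≤ γ) : v (1 - x * y) ≤ γ := by
  rw [show 1 - x * y = (1 - x) + x * (1 - y) by ring]
  refine v.map_add_le hx ?_
  rwa [map_mul, h.val_of_near hx, one_mul]

theorem ne_zero_of_near (hy : v (1 - y) ≤ γ) : y ≠ 0 := fun h0 => by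
  have := h.val_of_near hy
  simp [h0] at this

theorem near_inv (hy : v (1 - y) ≤ γ) : v (1 - y⁻¹) ≤ γ := by
  have h0 := h.ne_zero_of_near hy
  rw [show 1 - y⁻¹ = -(y⁻¹ * (1 - y)) by field_simp; ring, Valuation.map_neg, map_mul, map_inv₀,
    h.val_of_near hy]
  simpa using hy

theorem p_ne_zero : p ≠ 0 := fun h0 => by
  have := h.val_p
  simp [h0] at this

theorem u_ne_zero : u ≠ 0 := h.ne_zero_of_near h.near

theorem val_a : v a = 1 := by
  have := congrArg v h.top
  simpa [h.val_p, h.val_of_near h.near] using this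

theorem a_ne_zero : a ≠ 0 := fun h0 => by
  have := h.val_a
  simp [h0] at this

theorem val_P_mul (hy : v (1 - y) ≤ γ) : ∀ i < N, v (1 - p * y * p ^ i) = 1 := by
  intro i hi
  refine valuation_eq_one_of_sub_lt (h.val_P i hi) ?_
  rw [show 1 - p * y * p ^ i - (1 - p ^ (i + 1)) = p ^ (i + 1) * (1 - y) by ring]
  simpa [h.val_p] using hy.trans_lt h.lt_one

theorem val_P_div (hy : v (1 - y) ≤ γ) : ∀ i < N, v (1 - p / y * p ^ i) = 1 := by
  simpa only [div_eq_mul_inv] using h.val_P_mul (h.near_inv hy)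

theorem val_Q_mul (hy : v (1 - y) ≤ γ) : ∀ i < N, v (1 - a * y * p ^ i) = 1 := by
  intro i hi
  obtain ⟨j, hj⟩ : ∃ j, N = i + (j + 1) := ⟨N - i - 1, by omega⟩
  have e : v (p ^ (j + 1) * (1 - a * y * p ^ i)) = 1 := by
    -- Multiplying by the unit p^(N-i) replaces a p^i by u, so the factor is close to p^(N-i) - 1, a
    -- unit.
    rw [show p ^ (j + 1) * (1 - a * y * p ^ i) = p ^ (j + 1) - u * y by
      rw [← h.top, hj, pow_add]; ring]
    refine valuation_eq_one_of_sub_lt (y := -(1 - p ^ (j + 1)))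
      (by rw [Valuation.map_neg]; exact h.val_P j (by omega)) ?_
    rw [show p ^ (j + 1) - u * y - -(1 - p ^ (j + 1)) = 1 - u * y by ring]
    exact (h.near_mul h.near hy).trans_lt h.lt_one
  simpa [h.val_p] using e

theorem val_Q_div (hy : v (1 - y) ≤ γ) : ∀ i < N, v (1 - a / y * p ^ i) = 1 := by
  simpa only [div_eq_mul_inv] using h.val_Q_mul (h.near_inv hy)

theorem val_Q : ∀ i < N, v (1 - a * p ^ i) = 1 := by
  simpa using h.val_Q_mul near_one

theorem one_sub_a_ne_zero : 1 - a ≠ 0 := by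
  simpa using ne_zero_of_val (h.val_Q 0 h.pos)

theorem one_sub_P_ne_zero : ∀ i < N, 1 - p ^ (i + 1) ≠ 0 :=
  fun i hi => ne_zero_of_val (h.val_P i hi)

theorem one_sub_aP_ne_zero : ∀ i < 2 * N, 1 - a * p * p ^ i ≠ 0 := by
  intro i hi
  rcases lt_trichotomy (i + 1) N with h1 | h1 | h1
  · rw [mul_assoc, ← pow_succ']
    exact ne_zero_of_val (h.val_Q _ h1)
  -- This factor is 1-u: it is not a unit, and it is nonzero only because u ≠ 1.
  · rw [mul_assoc, ← pow_succ', h1, h.top]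
    exact sub_ne_zero.2 h.ne_one.symm
  · obtain ⟨j, rfl⟩ : ∃ j, i = N + j := ⟨i - N, by omega⟩
    rw [show a * p * p ^ (N + j) = p * u * p ^ j by rw [← h.top]; ring]
    exact ne_zero_of_val (h.val_P_mul h.near j (by omega))

theorem val_poch_P (hy : v (1 - y) ≤ γ) {k : ℕ} (hk : k ≤ N) : v (poch (p * y) p k) = 1 :=
  valuation_poch_eq_one fun i hi => h.val_P_mul hy i (by omega)

theorem val_poch_P_div (hy : v (1 - y) ≤ γ) {k : ℕ} (hk : k ≤ N) : v (poch (p / y) p k) = 1 := by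
  simpa only [div_eq_mul_inv] using h.val_poch_P (h.near_inv hy) hk

theorem val_poch_p {k : ℕ} (hk : k ≤ N) : v (poch p p k) = 1 := by
  simpa using h.val_poch_P near_one hk

theorem val_poch_Q (hy : v (1 - y) ≤ γ) {k : ℕ} (hk : k ≤ N) : v (poch (a * y) p k) = 1 :=
  valuation_poch_eq_one fun i hi => h.val_Q_mul hy i (by omega)

theorem val_poch_a {k : ℕ} (hk : k ≤ N) : v (poch a p k) = 1 := by
  simpa using h.val_poch_Q near_one hk

/-- The pair at u contains a/u = p^(-N), so the sum terminates by itself and Watson applies with y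
still free. On the right y enters only through the denominator. -/
theorem sum_at_u (hy : v (1 - y) ≤ γ) :
    ∑ k ∈ range (N + 1), baseTerm a p k * pairRatio a p u k * pairRatio a p y k *
        (poch a p k / poch p p k) =
      ∑ n ∈ range (N + 1), balancedCoeff a p u N n *
        (poch (a * u) p n * poch (a / u) p n / (poch (p * y) p n * poch (p / y) p n)) := by
  have ha0 := h.a_ne_zero
  have hu0 := h.u_ne_zero
  have hp0 := h.p_ne_zero
  have hy0 := h.ne_zero_of_near hy
  have W := watson_of_mul_pow a p u (a * y) (a / y) (a * u) a (p / a) (p / (a * u))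
    (p * y) (p / y) p (p / u) N (by field_simp) (by field_simp) (by field_simp) (by field_simp)
    (by field_simp) (by field_simp) h.top hu0 hp0 h.one_sub_a_ne_zero h.one_sub_P_ne_zero
    h.one_sub_aP_ne_zero (fun i hi => ne_zero_of_val (h.val_P_mul hy i hi))
    (fun i hi => ne_zero_of_val (h.val_P_div hy i hi))
    (fun i hi => by rw [← pow_succ']; exact h.one_sub_P_ne_zero i hi)
    (fun i hi => ne_zero_of_val (h.val_P_div h.near i hi))
  have n1 : poch p p N ≠ 0 := ne_zero_of_val (h.val_poch_p le_rfl)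
  have n2 : poch (p / u) p N ≠ 0 := ne_zero_of_val (h.val_poch_P_div h.near le_rfl)
  apply mul_left_cancel₀ (mul_ne_zero n1 n2)
  trans poch p p N * poch (p / u) p N *
        ∑ r ∈ range (N + 1), (1 - a * p ^ (2 * r)) * (poch a p r / poch p p r) *
          (poch (a / u) p r / poch (p * u) p r) *
          (poch (a * y) p r * poch (a / y) p r / (poch (p * y) p r * poch (p / y) p r)) *
          (poch (a * u) p r * poch a p r / (poch p p r * poch (p / u) p r)) *
            (p / a * (p / (a * u)) * p ^ N) ^ r
  · congr 1
    refine sum_congr rfl fun k hk => ?_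
    rw [show p / a * (p / (a * u)) * p ^ N = p ^ 2 / a ^ 3 by
      field_simp; exact h.top, baseTerm, pairRatio, pairRatio]
    simp only [div_eq_mul_inv, mul_inv]
    ring
  · rw [← W, mul_sum, mul_sum]
    refine sum_congr rfl fun n hn => ?_
    have hn : n ≤ N := by simpa [Nat.lt_succ_iff] using hn
    have R := poch_reflect_prefactor hn h.top hu0 ha0 hp0
    have n3 : poch p p (N - n) ≠ 0 := ne_zero_of_val (h.val_poch_p (by omega))
    have n4 : poch p p n ≠ 0 := ne_zero_of_val (h.val_poch_p hn)
    have n5 : poch (p * y) p n ≠ 0 := ne_zero_of_val (h.val_poch_P hy hn)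
    have n6 : poch (p / y) p n ≠ 0 := ne_zero_of_val (h.val_poch_P_div hy hn)
    rw [balancedCoeff]
    calc _ = (poch a p N * (poch (p / (a * u)) p (N - n) * (p / (a * u)) ^ n) * poch p p N) *
        ((1 - u) * poch (a * u) p n * poch a p n / poch p p (N - n) *
          (poch (p / a) p n / (poch p p n * poch (p * y) p n * poch (p / y) p n))) := by ring
      _ = _ := by
        rw [R]
        generalize poch p p (N - n) = z1 at *
        generalize poch p p n = z2 at *
        generalize poch (p * y) p n = z3 at *
        generalize poch (p / y) p n = z4 at *
        generalize poch p p N = z5 at *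
        generalize (a ^ N)⁻¹ = z6 at *
        generalize poch (p / u) p N = z7 at *
        generalize poch (p / a) p n = z8 at *
        generalize poch (a / u) p n = z9 at *
        field_simp

/-- Here the deformed last ratio supplies a/u, so both x and y stay free. In each summand on the
right the dependence on x and the dependence on y are separate factors. -/
theorem sum_at_inv_u (hx : v (1 - x) ≤ γ) (hy : v (1 - y) ≤ γ) :
    ∑ k ∈ range (N + 1), baseTerm a p k * pairRatio a p x k * pairRatio a p y k *
        (poch (a / u) p k / poch (p * u) p k * u ^ k) =
      ∑ n ∈ range (N + 1), balancedCoeff' a p u N n *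
        (poch (a * y) p n * poch (a / y) p n / (poch (p * y) p N * poch (p / y) p N)) *
        (poch (p * x) p n * poch (p / x) p n)⁻¹ := by
  have ha0 := h.a_ne_zero
  have hu0 := h.u_ne_zero
  have hp0 := h.p_ne_zero
  have hx0 := h.ne_zero_of_near hx
  have hy0 := h.ne_zero_of_near hy
  have W := watson_of_mul_pow a p u (a * x) (a / x) (a * y) (a / y) (p / a) (p / a)
    (p * x) (p / x) (p * y) (p / y) N (by field_simp) (by field_simp) (by field_simp)
    (by field_simp) (by field_simp) (by field_simp) h.top hu0 hp0 h.one_sub_a_ne_zero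
    h.one_sub_P_ne_zero h.one_sub_aP_ne_zero (fun i hi => ne_zero_of_val (h.val_P_mul hx i hi))
    (fun i hi => ne_zero_of_val (h.val_P_div hx i hi))
    (fun i hi => ne_zero_of_val (h.val_P_mul hy i hi))
    (fun i hi => ne_zero_of_val (h.val_P_div hy i hi))
  have n1 : poch (p * y) p N ≠ 0 := ne_zero_of_val (h.val_poch_P hy le_rfl)
  have n2 : poch (p / y) p N ≠ 0 := ne_zero_of_val (h.val_poch_P_div hy le_rfl)
  apply mul_left_cancel₀ (mul_ne_zero n1 n2)
  trans poch (p * y) p N * poch (p / y) p N *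
        ∑ r ∈ range (N + 1), (1 - a * p ^ (2 * r)) * (poch a p r / poch p p r) *
          (poch (a / u) p r / poch (p * u) p r) *
          (poch (a * x) p r * poch (a / x) p r / (poch (p * x) p r * poch (p / x) p r)) *
          (poch (a * y) p r * poch (a / y) p r / (poch (p * y) p r * poch (p / y) p r)) *
            (p / a * (p / a) * p ^ N) ^ r
  · congr 1
    refine sum_congr rfl fun k hk => ?_
    rw [show p / a * (p / a) * p ^ N = p ^ 2 / a ^ 3 * u by
      rw [← h.top]; field_simp, baseTerm, pairRatio, pairRatio, mul_pow]
    ring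
  · rw [← W, mul_sum, mul_sum]
    refine sum_congr rfl fun n hn => ?_
    rw [balancedCoeff']
    have e : ∀ z : K, poch (p * y) p N * poch (p / y) p N *
        (z / (poch (p * y) p N * poch (p / y) p N)) = z := fun z =>
      mul_div_cancel₀ _ (mul_ne_zero n1 n2)
    calc _ = (poch p p N * poch a p N * (1 - u) * (p / a) ^ n * poch (p / a) p (N - n) *
        poch (p / a) p n / (poch p p (N - n) * poch p p n)) *
          (poch (a * y) p n * poch (a / y) p n) * (poch (p * x) p n * poch (p / x) p n)⁻¹ := by
          simp only [div_eq_mul_inv, mul_inv]; ring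
      _ = _ := by
          have e' := e (poch (a * y) p n * poch (a / y) p n)
          generalize poch (a * y) p n * poch (a / y) p n /
            (poch (p * y) p N * poch (p / y) p N) = Z at *
          rw [← e']
          ring

end LocalData

end Local
end QSeries

namespace QSeries

/-! ### Expansions around u = 1 and the vanishing leading coefficient. -/

section Local

variable {K : Type*} [Field K] {Γ : Type*} [LinearOrderedCommGroupWithZero Γ]

/-- Factor by factor, (1-Qu)(1-Q/u) = (1-Q)² - Q(1-u)²/u. Symmetry under u ↦ 1/u is what makes the
deviation of second order in 1-u. -/
theorem pair_poch_eq (c p u : K) (hu : u ≠ 0) (k : ℕ) (hc : ∀ i < k, 1 - c * p ^ i ≠ 0) :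
    poch (c * u) p k * poch (c / u) p k = poch c p k ^ 2 *
      ∏ i ∈ range k, (1 + (1 - u) ^ 2 / u * -(c * p ^ i / (1 - c * p ^ i) ^ 2)) := by
  simp only [poch, ← prod_pow, ← prod_mul_distrib]
  refine prod_congr rfl fun i hi => ?_
  have := hc i (mem_range.1 hi)
  rw [div_mul_eq_mul_div c u, mul_right_comm c u]
  generalize c * p ^ i = Q at *
  field_simp
  ring

namespace LocalData

variable {v : Valuation K Γ} {γ : Γ} {a p u y x : K} {N : ℕ} (h : LocalData v γ a p u N)
include h

theorem val_delta : v ((1 - u) ^ 2 / u) ≤ γ ^ 2 := by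
  rw [map_div₀, h.val_of_near h.near, div_one, map_pow]
  exact pow_le_pow_left' h.near 2

theorem val_delta_lt : v ((1 - u) ^ 2 / u) < 1 :=
  h.val_delta.trans_lt (pow_lt_one₀ zero_le h.lt_one two_ne_zero)

theorem val_div_sq {c : K} {i : ℕ} (hc : v c = 1) (h1 : v (1 - c * p ^ i) = 1) :
    v (c * p ^ i / (1 - c * p ^ i) ^ 2) ≤ 1 := by
  simp [hc, h1, h.val_p]

theorem pair_firstOrder {c : K} {k : ℕ} (hc : v c = 1) (h1 : ∀ i < k, v (1 - c * p ^ i) = 1) :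
    FirstOrder v ((1 - u) ^ 2 / u) (poch (c * u) p k * poch (c / u) p k / poch c p k ^ 2)
      (∑ i ∈ range k, -(c * p ^ i / (1 - c * p ^ i) ^ 2)) := by
  have h0 : poch c p k ≠ 0 := ne_zero_of_val (valuation_poch_eq_one h1)
  rw [pair_poch_eq c p u h.u_ne_zero k (fun i hi => ne_zero_of_val (h1 i hi)),
    mul_div_cancel_left₀ _ (pow_ne_zero 2 h0)]
  refine FirstOrder.prod h.val_delta_lt fun i hi => FirstOrder.one_add ?_
  rw [Valuation.map_neg]
  exact h.val_div_sq hc (h1 i (mem_range.1 hi))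

theorem pairP_firstOrder {k : ℕ} (hk : k ≤ N) :
    FirstOrder v ((1 - u) ^ 2 / u) (poch (p * u) p k * poch (p / u) p k / poch p p k ^ 2)
      (∑ i ∈ range k, -(p * p ^ i / (1 - p * p ^ i) ^ 2)) :=
  h.pair_firstOrder h.val_p fun i hi => by rw [← pow_succ']; exact h.val_P i (by omega)

theorem pairQ_firstOrder {k : ℕ} (hk : k ≤ N) :
    FirstOrder v ((1 - u) ^ 2 / u) (poch (a * u) p k * poch (a / u) p k / poch a p k ^ 2)
      (∑ i ∈ range k, -(a * p ^ i / (1 - a * p ^ i) ^ 2)) :=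
  h.pair_firstOrder h.val_a fun i hi => h.val_Q i (by omega)

/-- First-order coefficient of the ratio of symmetric pairs. -/
theorem pairRatio_firstOrder {k : ℕ} (hk : k ≤ N) :
    FirstOrder v ((1 - u) ^ 2 / u) (pairRatio a p u k / pairRatio a p 1 k)
      (∑ i ∈ range k, (p * p ^ i / (1 - p * p ^ i) ^ 2 - a * p ^ i / (1 - a * p ^ i) ^ 2)) := by
  have H := (h.pairQ_firstOrder hk).mul ((h.pairP_firstOrder hk).inv h.val_delta_lt) h.val_delta_lt
  convert H using 1
  · rw [pairRatio_one, pairRatio, inv_div, div_pow]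
    simp only [div_eq_mul_inv, mul_inv, inv_inv]
    ring
  · rw [sum_neg_distrib, sum_neg_distrib, neg_neg, sum_sub_distrib]; ring

theorem val_eps : v (1 - u⁻¹) ≤ γ := h.near_inv h.near

/-- There is no symmetry under u ↦ 1/u here, so the deviation is only of first order in 1 - u⁻¹. The
power u^k is distributed as one u per factor. -/
theorem last_firstOrder {k : ℕ} (hk : k ≤ N) :
    FirstOrder v (1 - u⁻¹)
      (poch (a / u) p k / poch (p * u) p k * u ^ k / (poch a p k / poch p p k))
      (∑ i ∈ range k, (a * p ^ i / (1 - a * p ^ i) + 1 / (1 - p * p ^ i))) := by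
  have hu0 := h.u_ne_zero
  have hε := h.val_eps.trans_lt h.lt_one
  have e : poch (a / u) p k / poch (p * u) p k * u ^ k / (poch a p k / poch p p k) =
      ∏ i ∈ range k, ((1 + (1 - u⁻¹) * (a * p ^ i / (1 - a * p ^ i))) *
        (1 + (1 - u⁻¹) * -(1 / (1 - p * p ^ i)))⁻¹) := by
    rw [show u ^ k = ∏ _i ∈ range k, u by simp]
    simp only [poch, ← prod_div_distrib, ← prod_mul_distrib]
    refine prod_congr rfl fun i hi => ?_
    have hi := mem_range.1 hi
    have d1 := ne_zero_of_val (h.val_Q i (by omega))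
    have d2 := ne_zero_of_val (h.val_P_mul (y := 1) near_one i (by omega))
    have d3 := ne_zero_of_val (h.val_P_mul h.near i (by omega))
    rw [mul_one] at d2
    have d4 : 1 + (1 - u⁻¹) * -(1 / (1 - p * p ^ i)) = (1 - p * u * p ^ i) / (u * (1 - p * p ^ i)) := by
      field_simp
      ring
    rw [d4]
    rw [mul_right_comm p u, div_mul_eq_mul_div a u] at *
    generalize a * p ^ i = Q at *
    generalize p * p ^ i = P at *
    field_simp
    ring
  rw [e]
  refine FirstOrder.prod hε fun i hi => ?_
  have hi := mem_range.1 hi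
  have d1 := h.val_Q i (by omega)
  have d2 := h.val_P_mul (y := 1) near_one i (by omega)
  rw [mul_one] at d2
  have F1 : FirstOrder v (1 - u⁻¹) (1 + (1 - u⁻¹) * (a * p ^ i / (1 - a * p ^ i)))
      (a * p ^ i / (1 - a * p ^ i)) := FirstOrder.one_add (by simp [d1, h.val_a, h.val_p])
  have F2 : FirstOrder v (1 - u⁻¹) (1 + (1 - u⁻¹) * -(1 / (1 - p * p ^ i)))
      (-(1 / (1 - p * p ^ i))) := FirstOrder.one_add (by rw [Valuation.map_neg]; simp [d2])
  have := F1.mul (F2.inv hε) hε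
  rwa [neg_neg] at this

theorem modEq_a : ModEq v γ a (a / u) := by
  have hu0 := h.u_ne_zero
  refine ⟨h.val_a.le, by simp [h.val_a, h.val_of_near h.near], ?_⟩
  rw [show a - a / u = -(a / u * (1 - u)) by field_simp; ring, Valuation.map_neg, map_mul, map_div₀,
    h.val_a, h.val_of_near h.near]
  simpa using h.near

theorem a_div_mul_pow : a / u * p ^ N = 1 := by
  rw [div_mul_eq_mul_div, h.top, div_self h.u_ne_zero]

theorem a_div_mul_pow_eq {i : ℕ} (hi : i < N) : a / u * p ^ i = (p ^ (N - i))⁻¹ := by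
  have := h.a_div_mul_pow
  have hp0 := h.p_ne_zero
  apply eq_inv_of_mul_eq_one_left
  rw [mul_assoc, ← pow_add, show i + (N - i) = N by omega, this]

theorem val_vwpTerm_modEq {k : ℕ} (hk : k ≤ N) :
    ModEq v γ (vwpTerm a p k) (vwpTerm (a / u) p k) := by
  have hm := h.modEq_a
  have vp : ∀ n : ℕ, v (p ^ n) ≤ 1 := fun n => by simp [h.val_p]
  have vau : v (a / u) = 1 := by simp [h.val_a, h.val_of_near h.near]
  refine (((ModEq.refl (by simp)).sub' (hm.mul (ModEq.refl (vp _)))).mul (ModEq.pow ?_ 6)).mul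
    (ModEq.pow ?_ k)
  · rw [div_eq_mul_inv, div_eq_mul_inv]
    exact (hm.poch h.val_p.le k).mul (ModEq.refl (by simp [h.val_poch_p hk]))
  · rw [div_eq_mul_inv, div_eq_mul_inv]
    exact (ModEq.refl (vp _)).mul ((hm.pow 3).inv (by simp [h.val_a]) (by simp [vau]))

theorem modEq_Q {i : ℕ} (hi : i < N) : ModEq v γ (a * p ^ i) (p ^ (N - i))⁻¹ := by
  rw [← h.a_div_mul_pow_eq hi]
  exact h.modEq_a.mul (ModEq.refl (by simp [h.val_p]))

theorem val_one_sub_inv {i : ℕ} (hi : i < N) : v (1 - (p ^ (N - i))⁻¹) = 1 := by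
  rw [← h.a_div_mul_pow_eq hi]
  exact h.val_Q_div h.near i hi

theorem modEq_one_sub_inv {i : ℕ} (hi : i < N) :
    ModEq v γ (1 - a * p ^ i)⁻¹ (1 - (p ^ (N - i))⁻¹)⁻¹ :=
  ((ModEq.refl (by simp)).sub' (h.modEq_Q hi)).inv (h.val_Q i hi) (h.val_one_sub_inv hi)

theorem one_sub_pow_ne_zero {i : ℕ} (hi : i < N) : 1 - p ^ (N - i) ≠ 0 := by
  have := h.one_sub_P_ne_zero (N - i - 1) (by omega)
  rwa [show N - i - 1 + 1 = N - i by omega] at this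

/-- Modulo γ, a p^i is the inverse of p^(N-i), and x/(1-x)² is invariant under x ↦ 1/x. The result
has the palindromic shape φ(i+1) - φ(N-i). -/
theorem pairCoeff_modEq {k : ℕ} (hk : k ≤ N) :
    ModEq v γ
      (∑ i ∈ range k, (p * p ^ i / (1 - p * p ^ i) ^ 2 - a * p ^ i / (1 - a * p ^ i) ^ 2))
      (∑ i ∈ range k, (p ^ (i + 1) / (1 - p ^ (i + 1)) ^ 2 -
        p ^ (N - i) / (1 - p ^ (N - i)) ^ 2)) := by
  have hp0 := h.p_ne_zero
  refine ModEq.sum fun i hi => ?_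
  have hi : i < N := by have := mem_range.1 hi; omega
  rw [← pow_succ' p i]
  refine (ModEq.refl ?_).sub' ?_
  · simp [h.val_p, h.val_P i hi]
  · have e : p ^ (N - i) / (1 - p ^ (N - i)) ^ 2 =
        (p ^ (N - i))⁻¹ * ((1 - (p ^ (N - i))⁻¹)⁻¹) ^ 2 := by
      have h1 := h.one_sub_pow_ne_zero hi
      have h2 : p ^ (N - i) ≠ 0 := pow_ne_zero _ hp0
      have h3 := ne_zero_of_val (h.val_one_sub_inv hi)
      generalize p ^ (N - i) = P at *
      have h4 : P - 1 ≠ 0 := sub_ne_zero.2 (sub_ne_zero.1 h1).symm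
      rw [show 1 - P⁻¹ = -(1 - P) / P by field_simp; ring]
      field_simp
    rw [e, div_eq_mul_inv, ← inv_pow]
    exact (h.modEq_Q hi).mul ((h.modEq_one_sub_inv hi).pow 2)

/-- The same reduction, now with x/(1-x) = -1/(1-x⁻¹). -/
theorem lastCoeff_modEq {k : ℕ} (hk : k ≤ N) :
    ModEq v γ (∑ i ∈ range k, (a * p ^ i / (1 - a * p ^ i) + 1 / (1 - p * p ^ i)))
      (∑ i ∈ range k, (1 / (1 - p ^ (i + 1)) - 1 / (1 - p ^ (N - i)))) := by
  have hp0 := h.p_ne_zero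
  refine ModEq.sum fun i hi => ?_
  have hi : i < N := by have := mem_range.1 hi; omega
  rw [← pow_succ' p i]
  have e : 1 / (1 - p ^ (i + 1)) - 1 / (1 - p ^ (N - i)) =
      1 / (1 - p ^ (i + 1)) - (0 - (p ^ (N - i))⁻¹ * (1 - (p ^ (N - i))⁻¹)⁻¹) := by
    have h1 := h.one_sub_pow_ne_zero hi
    have h2 : p ^ (N - i) ≠ 0 := pow_ne_zero _ hp0
    congr 1
    generalize p ^ (N - i) = P at *
    rw [show 1 - P⁻¹ = -(1 - P) / P by field_simp; ring]
    field_simp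
    ring
  have e' : a * p ^ i / (1 - a * p ^ i) + 1 / (1 - p ^ (i + 1)) =
      1 / (1 - p ^ (i + 1)) - (0 - a * p ^ i * (1 - a * p ^ i)⁻¹) := by ring
  rw [e, e']
  exact (ModEq.refl (by simp [h.val_P i hi])).sub' ((ModEq.refl (by simp)).sub'
    ((h.modEq_Q hi).mul (h.modEq_one_sub_inv hi)))

/-- Replacing a by a/u = p^(-N) changes the sum only modulo γ. The weights become palindromic, so
the new sum is exactly zero by antisymmetry. -/
theorem val_leading_sum [CharZero K] :
    v (∑ k ∈ range (N + 1), vwpTerm a p k *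
      ((∑ i ∈ range k, (p * p ^ i / (1 - p * p ^ i) ^ 2 - a * p ^ i / (1 - a * p ^ i) ^ 2)) ^ 2 *
        ∑ i ∈ range k, (a * p ^ i / (1 - a * p ^ i) + 1 / (1 - p * p ^ i)))) ≤ γ := by
  have M := ModEq.sum (s := range (N + 1)) fun k hk =>
    have hk : k ≤ N := by simpa [Nat.lt_succ_iff] using hk
    (h.val_vwpTerm_modEq hk).mul (((h.pairCoeff_modEq hk).pow 2).mul (h.lastCoeff_modEq hk))
  have Z := sum_vwpTerm_mul_eq_zero (b := a / u) h.p_ne_zero h.a_div_mul_pow h.one_sub_P_ne_zero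
    (fun k => (∑ i ∈ range k, (p ^ (i + 1) / (1 - p ^ (i + 1)) ^ 2 -
        p ^ (N - i) / (1 - p ^ (N - i)) ^ 2)) ^ 2 *
      ∑ i ∈ range k, (1 / (1 - p ^ (i + 1)) - 1 / (1 - p ^ (N - i))))
    (fun k hk => by
      rw [palindromic_sum_sub_reflect N (fun j => p ^ j / (1 - p ^ j) ^ 2) hk,
        palindromic_sum_sub_reflect N (fun j => 1 / (1 - p ^ j)) hk])
  rw [Z] at M
  simpa using M.sub

end LocalData

end Local
end QSeries

namespace QSeries

/-! ### The congruence modulo the sixth power. -/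

section Local

variable {K : Type*} [Field K] {Γ : Type*} [LinearOrderedCommGroupWithZero Γ]

namespace LocalData

variable {v : Valuation K Γ} {γ : Γ} {a p u y x : K} {N : ℕ} (h : LocalData v γ a p u N)
include h

theorem val_vwpTerm_le {k : ℕ} (hk : k ≤ N) : v (vwpTerm a p k) ≤ 1 :=
  (h.val_vwpTerm_modEq hk).left

/-- The triple mixed difference is of sixth order. -/
theorem val_triple_difference [CharZero K] :
    v (∑ k ∈ range (N + 1), baseTerm a p k * (pairRatio a p 1 k - pairRatio a p u k) ^ 2 *
      (poch a p k / poch p p k - poch (a / u) p k / poch (p * u) p k * u ^ k)) ≤ γ ^ 6 := by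
  set δ := (1 - u) ^ 2 / u with hδ
  set ε := 1 - u⁻¹ with hε
  let α : ℕ → K := fun k =>
    ∑ i ∈ range k, (p * p ^ i / (1 - p * p ^ i) ^ 2 - a * p ^ i / (1 - a * p ^ i) ^ 2)
  let β : ℕ → K := fun k => ∑ i ∈ range k, (a * p ^ i / (1 - a * p ^ i) + 1 / (1 - p * p ^ i))
  let ρ : ℕ → K := fun k => pairRatio a p u k / pairRatio a p 1 k
  let ζ : ℕ → K := fun k =>
    poch (a / u) p k / poch (p * u) p k * u ^ k / (poch a p k / poch p p k)
  have vδ : v δ ≤ γ ^ 2 := h.val_delta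
  have vε : v ε ≤ γ := h.val_eps
  have e1 : ∀ k ∈ range (N + 1), baseTerm a p k * (pairRatio a p 1 k - pairRatio a p u k) ^ 2 *
      (poch a p k / poch p p k - poch (a / u) p k / poch (p * u) p k * u ^ k) =
      vwpTerm a p k * ((1 - ρ k) ^ 2 * (1 - ζ k) + δ ^ 2 * ε * (α k ^ 2 * β k)) -
        δ ^ 2 * ε * (vwpTerm a p k * (α k ^ 2 * β k)) := by
    intro k hk
    have hk : k ≤ N := by simpa [Nat.lt_succ_iff] using hk
    have n1 : poch a p k ≠ 0 := ne_zero_of_val (h.val_poch_a hk)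
    have n2 : poch p p k ≠ 0 := ne_zero_of_val (h.val_poch_p hk)
    have n3 : poch a p k / poch p p k ≠ 0 := div_ne_zero n1 n2
    have n4 : pairRatio a p 1 k ≠ 0 := by rw [pairRatio_one]; exact pow_ne_zero 2 n3
    have g1 : pairRatio a p 1 k - pairRatio a p u k = pairRatio a p 1 k * (1 - ρ k) := by
      simp only [ρ]; field_simp
    have g2 : poch a p k / poch p p k - poch (a / u) p k / poch (p * u) p k * u ^ k =
        poch a p k / poch p p k * (1 - ζ k) := by
      simp only [ζ]
      generalize poch a p k / poch p p k = z at *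
      field_simp
    rw [g1, g2, vwpTerm_eq]
    ring
  rw [sum_congr rfl e1, sum_sub_distrib, ← mul_sum]
  refine v.map_sub_le (v.map_sum_le fun k hk => ?_) ?_
  · have hk : k ≤ N := by simpa [Nat.lt_succ_iff] using hk
    have R : FirstOrder v δ (ρ k) (α k) := h.pairRatio_firstOrder hk
    have Z : FirstOrder v ε (ζ k) (β k) := h.last_firstOrder hk
    rw [map_mul]
    refine mul_le_of_le_one_of_le (h.val_vwpTerm_le hk) ?_
    -- Both errors have order 6: (ρ-1)² - (δα)² is a difference of squares of order 4+2, and (δα)²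
    -- times the error of ζ is of order 4+2.
    rw [show (1 - ρ k) ^ 2 * (1 - ζ k) + δ ^ 2 * ε * (α k ^ 2 * β k) =
      (ρ k - 1 - δ * α k) * ((ρ k - 1) + δ * α k) * -(ζ k - 1) -
        (δ * α k) ^ 2 * (ζ k - 1 - ε * β k) by ring]
    have b1 := R.sub_one h.val_delta_lt
    have b2 : v (δ * α k) ≤ v δ := by rw [map_mul]; exact mul_le_of_le_one_right' R.coeff
    have b3 := Z.sub_one (vε.trans_lt h.lt_one)
    refine v.map_sub_le ?_ ?_
    · rw [map_mul, map_mul, Valuation.map_neg]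
      have c1 : v (ρ k - 1 - δ * α k) ≤ γ ^ 4 :=
        R.sub.trans (by simpa [← pow_mul] using pow_le_pow_left' vδ 2)
      have c2 : v (ρ k - 1 + δ * α k) ≤ γ ^ 2 := (v.map_add_le b1 b2).trans vδ
      have c3 : v (ζ k - 1) ≤ 1 := b3.trans (vε.trans h.lt_one.le)
      calc _ ≤ γ ^ 4 * γ ^ 2 * 1 := mul_le_mul' (mul_le_mul' c1 c2) c3
        _ = γ ^ 6 := by rw [mul_one, ← pow_add]
    · rw [map_mul, map_pow]
      calc _ ≤ (γ ^ 2) ^ 2 * γ ^ 2 :=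
            mul_le_mul' (pow_le_pow_left' (b2.trans vδ) 2) (Z.sub.trans (pow_le_pow_left' vε 2))
        _ = γ ^ 6 := by rw [← pow_mul, ← pow_add]
  · rw [map_mul, map_mul, map_pow]
    calc _ ≤ (γ ^ 2) ^ 2 * γ * γ :=
          mul_le_mul' (mul_le_mul' (pow_le_pow_left' vδ 2) vε) h.val_leading_sum
      _ = γ ^ 6 := by rw [← pow_mul, ← pow_succ, ← pow_succ]

variable {c : ℕ} (hc : 1 ≤ c) (hcN : 2 * c ≤ N + 1) (hpc : v (1 - p ^ (N + c)) ≤ γ)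
include hc hcN hpc

omit hcN in
-- The factor with index c-1 equals 1 - p^(N+c)/u, a quotient of one-units subtracted from 1.
theorem val_poch_p_div_a {k : ℕ} (hk : c ≤ k) : v (poch (p / a) p k) ≤ γ := by
  refine valuation_poch_le_of_factor (i := c - 1) (by simp [h.val_p, h.val_a]) h.val_p.le (by omega) ?_
  have ha0 := h.a_ne_zero
  have hu0 := h.u_ne_zero
  have e : p / a * p ^ (c - 1) = p ^ (N + c) * u⁻¹ := by
    obtain ⟨d, rfl⟩ : ∃ d, c = d + 1 := ⟨c - 1, by omega⟩
    have hp0 := h.p_ne_zero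
    rw [← h.top, show d + 1 - 1 = d by omega]
    field_simp
    ring
  rw [e]
  exact h.near_mul hpc (h.near_inv h.near)

/-- For n ≥ c the second symbol is small. For n < c the first contains 1 - a²p^(N-c) = 1 -
u²p^(-(N+c)); the bound 2c ≤ N+1 puts this factor in range. -/
theorem val_poch_sq_mul {n : ℕ} (hn : n ≤ N) :
    v (poch (a ^ 2 * p ^ n) p (N - n)) * v (poch (p / a) p n) ≤ γ := by
  have vpa : v (p / a) = 1 := by simp [h.val_p, h.val_a]
  rcases le_or_gt c n with hcn | hcn
  · exact mul_le_of_le_one_of_le (valuation_poch_le_one (by simp [h.val_a, h.val_p]) h.val_p.le _)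
      (h.val_poch_p_div_a hc hpc hcn)
  · refine mul_le_of_le_of_le_one ?_ (valuation_poch_le_one vpa.le h.val_p.le _)
    refine valuation_poch_le_of_factor (i := N - c - n) (by simp [h.val_a, h.val_p]) h.val_p.le
      (by omega) ?_
    have e : a ^ 2 * p ^ n * p ^ (N - c - n) = u * u * (p ^ (N + c))⁻¹ := by
      obtain ⟨d, rfl⟩ : ∃ d, N = n + c + d := ⟨N - c - n, by omega⟩
      have hp0 := h.p_ne_zero
      rw [show n + c + d - c - n = d by omega, eq_mul_inv_iff_mul_eq₀ (pow_ne_zero _ hp0), ← h.top]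
      ring
    rw [e]
    exact h.near_mul (h.near_mul h.near h.near) (h.near_inv hpc)

theorem val_balancedCoeff {n : ℕ} (hn : n ≤ N) : v (balancedCoeff a p u N n) ≤ γ ^ 2 := by
  have h1 := h.val_poch_sq_mul hc hcN hpc hn
  have h2 := h.near
  simp only [balancedCoeff, map_mul, map_div₀, map_inv₀, map_pow, h.val_p, h.val_a,
    h.val_poch_p le_rfl, h.val_poch_p hn, h.val_poch_a hn, one_pow, inv_one, mul_one, div_one]
  rw [mul_assoc, sq γ]
  exact mul_le_mul' h2 h1

theorem val_balancedCoeff' {n : ℕ} (hn : n ≤ N) : v (balancedCoeff' a p u N n) ≤ γ ^ 2 := by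
  have vpa : v (p / a) = 1 := by simp [h.val_p, h.val_a]
  -- As 2c ≤ N+1, at least one of n and N-n is at least c.
  have h1 : v (poch (p / a) p (N - n)) * v (poch (p / a) p n) ≤ γ := by
    rcases le_or_gt c n with hcn | hcn
    · exact mul_le_of_le_one_of_le (valuation_poch_le_one vpa.le h.val_p.le _)
        (h.val_poch_p_div_a hc hpc hcn)
    · exact mul_le_of_le_of_le_one (h.val_poch_p_div_a hc hpc (by omega))
        (valuation_poch_le_one vpa.le h.val_p.le _)
  have h2 := h.near
  have h3 := h.val_poch_p (show N - n ≤ N by omega)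
  simp only [balancedCoeff', map_mul, map_div₀, map_pow, h.val_p, h.val_a,
    h.val_poch_p le_rfl, h.val_poch_p hn, h.val_poch_a le_rfl, h3, one_pow, mul_one, div_one,
    one_mul]
  rw [mul_assoc, sq γ]
  exact mul_le_mul' h2 h1

/-- The double mixed difference at the parameter `u⁻¹` is of sixth order. -/
theorem val_double_difference :
    v (∑ k ∈ range (N + 1), baseTerm a p k * (pairRatio a p 1 k - pairRatio a p u k) ^ 2 *
      (poch (a / u) p k / poch (p * u) p k * u ^ k)) ≤ γ ^ 6 := by
  have e : ∑ k ∈ range (N + 1), baseTerm a p k * (pairRatio a p 1 k - pairRatio a p u k) ^ 2 *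
      (poch (a / u) p k / poch (p * u) p k * u ^ k) =
      ∑ n ∈ range (N + 1), balancedCoeff' a p u N n *
        ((poch a p n ^ 2 / poch p p N ^ 2 -
          poch (a * u) p n * poch (a / u) p n / (poch (p * u) p N * poch (p / u) p N)) *
        ((poch p p n ^ 2)⁻¹ - (poch (p * u) p n * poch (p / u) p n)⁻¹)) := by
    have f11 := h.sum_at_inv_u (x := 1) (y := 1) near_one near_one
    have f1u := h.sum_at_inv_u (x := 1) (y := u) near_one h.near
    have fu1 := h.sum_at_inv_u (x := u) (y := 1) h.near near_one
    have fuu := h.sum_at_inv_u (x := u) (y := u) h.near h.near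
    simp only [mul_one, div_one] at f11 f1u fu1 fuu
    trans (∑ k ∈ range (N + 1), baseTerm a p k * pairRatio a p 1 k * pairRatio a p 1 k *
        (poch (a / u) p k / poch (p * u) p k * u ^ k)) -
      (∑ k ∈ range (N + 1), baseTerm a p k * pairRatio a p 1 k * pairRatio a p u k *
        (poch (a / u) p k / poch (p * u) p k * u ^ k)) -
      (∑ k ∈ range (N + 1), baseTerm a p k * pairRatio a p u k * pairRatio a p 1 k *
        (poch (a / u) p k / poch (p * u) p k * u ^ k)) +
      (∑ k ∈ range (N + 1), baseTerm a p k * pairRatio a p u k * pairRatio a p u k *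
        (poch (a / u) p k / poch (p * u) p k * u ^ k))
    · rw [← sum_sub_distrib, ← sum_sub_distrib, ← sum_add_distrib]
      exact sum_congr rfl fun k _ => by ring
    · rw [f11, f1u, fu1, fuu, ← sum_sub_distrib, ← sum_sub_distrib, ← sum_add_distrib]
      -- Since x and y separate, the second difference factors into one difference in y times one in
      -- x, for each n.
      exact sum_congr rfl fun k _ => by ring
  rw [e]
  refine v.map_sum_le fun n hn => ?_
  have hn : n ≤ N := by simpa [Nat.lt_succ_iff] using hn
  rw [map_mul, map_mul, show γ ^ 6 = γ ^ 2 * (γ ^ 2 * γ ^ 2) by rw [← pow_add, ← pow_add]]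
  have hlt := h.val_delta_lt
  have n1 : poch p p N ≠ 0 := ne_zero_of_val (h.val_poch_p le_rfl)
  have n2 : poch p p n ≠ 0 := ne_zero_of_val (h.val_poch_p hn)
  have n3 : poch a p n ≠ 0 := ne_zero_of_val (h.val_poch_a hn)
  refine mul_le_mul' (h.val_balancedCoeff' hc hcN hpc hn) (mul_le_mul' ?_ ?_)
  · have F := ((h.pairQ_firstOrder hn).mul ((h.pairP_firstOrder le_rfl).inv hlt) hlt).sub_one hlt
    refine le_trans (le_of_eq ?_) (F.trans h.val_delta)
    refine Eq.trans ?_ (one_mul _)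
    rw [show (1 : Γ) = v (-(poch a p n ^ 2 / poch p p N ^ 2)) by
      rw [Valuation.map_neg]; simp [h.val_poch_a hn, h.val_poch_p le_rfl], ← map_mul]
    congr 1
    rw [inv_div]
    generalize poch (p * u) p N = z1 at *
    generalize poch (p / u) p N = z2 at *
    generalize poch (a / u) p n = z3 at *
    field_simp
    ring
  · have F := ((h.pairP_firstOrder hn).inv hlt).sub_one hlt
    refine le_trans (le_of_eq ?_) (F.trans h.val_delta)
    refine Eq.trans ?_ (one_mul _)
    rw [show (1 : Γ) = v (-(poch p p n ^ 2)⁻¹) by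
      rw [Valuation.map_neg]; simp [h.val_poch_p hn], ← map_mul]
    congr 1
    rw [inv_div]
    generalize poch (p * u) p n = z1 at *
    generalize poch (p / u) p n = z2 at *
    field_simp
    ring

/-- The coefficients already have order 2, so order 4 suffices for the rest. With ξ ≈ 1 - δA and η ≈
1 + δB one has ξ(2-η) ≈ 1 - δ(A+B) up to δ². -/
theorem val_balanced_comparison :
    v (∑ n ∈ range (N + 1), balancedCoeff a p u N n *
        (poch (a * u) p n * poch (a / u) p n *
          (2 / poch p p n ^ 2 - 1 / (poch (p * u) p n * poch (p / u) p n))) -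
      ∑ n ∈ range (N + 1), balancedCoeff a p u N n * (poch a p n ^ 2 / poch p p n ^ 2 *
        (1 - (1 - u) ^ 2 * (2 - u) * ∑ i ∈ range n,
          (p * p ^ i / (1 - p * p ^ i) ^ 2 + a * p ^ i / (1 - a * p ^ i) ^ 2)))) ≤ γ ^ 6 := by
  rw [← sum_sub_distrib]
  refine v.map_sum_le fun n hn => ?_
  have hn : n ≤ N := by simpa [Nat.lt_succ_iff] using hn
  have hlt := h.val_delta_lt
  have hu0 := h.u_ne_zero
  have n1 : poch p p n ≠ 0 := ne_zero_of_val (h.val_poch_p hn)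
  have n2 : poch a p n ≠ 0 := ne_zero_of_val (h.val_poch_a hn)
  have X := h.pairQ_firstOrder hn
  have Y := (h.pairP_firstOrder hn).inv hlt
  set δ := (1 - u) ^ 2 / u with hδ
  rw [sum_neg_distrib] at X Y
  rw [neg_neg] at Y
  rw [sum_add_distrib]
  have vδ : v δ ≤ γ ^ 2 := h.val_delta
  set A := ∑ i ∈ range n, a * p ^ i / (1 - a * p ^ i) ^ 2
  set B := ∑ i ∈ range n, p * p ^ i / (1 - p * p ^ i) ^ 2
  set ξ := poch (a * u) p n * poch (a / u) p n / poch a p n ^ 2 with hξ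
  set η := (poch (p * u) p n * poch (p / u) p n / poch p p n ^ 2)⁻¹ with hη
  have e : balancedCoeff a p u N n *
        (poch (a * u) p n * poch (a / u) p n *
          (2 / poch p p n ^ 2 - 1 / (poch (p * u) p n * poch (p / u) p n))) -
      balancedCoeff a p u N n * (poch a p n ^ 2 / poch p p n ^ 2 *
        (1 - (1 - u) ^ 2 * (2 - u) * (B + A))) =
      balancedCoeff a p u N n * (poch a p n ^ 2 / poch p p n ^ 2) *
        ((ξ - 1 - δ * -A) * (2 - η) + (1 + δ * -A) * -(η - 1 - δ * B) +
          δ * δ * (A * B) - (1 - u) ^ 4 / u * (B + A)) := by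
    have e1 : poch (a * u) p n * poch (a / u) p n = ξ * poch a p n ^ 2 := by
      rw [hξ]; field_simp
    have e2 : 1 / (poch (p * u) p n * poch (p / u) p n) = η / poch p p n ^ 2 := by
      rw [hη, inv_div]; field_simp
    -- The factor 2-u in the theorem is 1/u up to second order: 1/u = (2-u) + (1-u)²/u.
    have e3 : (1 - u) ^ 2 * (2 - u) = δ - (1 - u) ^ 4 / u := by
      rw [hδ]; field_simp; ring
    rw [e1, e2, e3]
    ring
  rw [e, map_mul, map_mul, show γ ^ 6 = γ ^ 2 * 1 * γ ^ 4 by rw [mul_one, ← pow_add]]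
  refine mul_le_mul' (mul_le_mul' (h.val_balancedCoeff hc hcN hpc hn)
    (by simp [h.val_poch_a hn, h.val_poch_p hn])) ?_
  have vA : v A ≤ 1 := by simpa using X.coeff
  have vB : v B ≤ 1 := Y.coeff
  have vδ2 : v δ ^ 2 ≤ γ ^ 4 := by simpa [← pow_mul] using pow_le_pow_left' vδ 2
  have v2 : v (2 : K) ≤ 1 := by simpa [one_add_one_eq_two] using v.map_add_le (x := 1) (y := 1) (g := 1) (by simp) (by simp)
  refine v.map_sub_le (v.map_add_le (v.map_add_le ?_ ?_) ?_) ?_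
  · rw [map_mul]
    exact mul_le_of_le_of_le_one (X.sub.trans vδ2) (v.map_sub_le v2 (Y.val hlt).le)
  · rw [map_mul, Valuation.map_neg]
    refine mul_le_of_le_one_of_le (v.map_add_le (by simp) ?_) (Y.sub.trans vδ2)
    rw [map_mul]
    exact mul_le_one' hlt.le X.coeff
  · rw [map_mul, map_mul, map_mul, ← sq]
    exact mul_le_of_le_of_le_one vδ2 (mul_le_one' vA vB)
  · rw [map_mul, map_div₀, h.val_of_near h.near, div_one, map_pow]
    exact mul_le_of_le_of_le_one (pow_le_pow_left' h.near 4) (v.map_add_le vB vA)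

/-- The supercongruence modulo the sixth power, at a single prime. -/
theorem main_congruence [CharZero K] (ha2 : ∀ i < N, 1 - a ^ 2 * p ^ i ≠ 0) :
    v (∑ k ∈ range (N + 1), vwpTerm a p k -
      (1 - u) * (a ^ N)⁻¹ * (poch (a ^ 2) p N / poch p p N) * ∑ n ∈ range (N + 1),
        poch a p n ^ 3 * poch (p / a) p n * p ^ n / (poch p p n ^ 3 * poch (a ^ 2) p n) *
        (1 - (1 - u) ^ 2 * (2 - u) * ∑ i ∈ range n,
          (p * p ^ i / (1 - p * p ^ i) ^ 2 + a * p ^ i / (1 - a * p ^ i) ^ 2))) ≤ γ ^ 6 := by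
  have f1 := h.sum_at_u (y := 1) near_one
  have fu := h.sum_at_u (y := u) h.near
  simp only [mul_one, div_one] at f1
  have e : ∑ k ∈ range (N + 1), vwpTerm a p k -
      (1 - u) * (a ^ N)⁻¹ * (poch (a ^ 2) p N / poch p p N) * ∑ n ∈ range (N + 1),
        poch a p n ^ 3 * poch (p / a) p n * p ^ n / (poch p p n ^ 3 * poch (a ^ 2) p n) *
        (1 - (1 - u) ^ 2 * (2 - u) * ∑ i ∈ range n,
          (p * p ^ i / (1 - p * p ^ i) ^ 2 + a * p ^ i / (1 - a * p ^ i) ^ 2)) =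
      (∑ n ∈ range (N + 1), balancedCoeff a p u N n *
        (poch (a * u) p n * poch (a / u) p n *
          (2 / poch p p n ^ 2 - 1 / (poch (p * u) p n * poch (p / u) p n))) -
      ∑ n ∈ range (N + 1), balancedCoeff a p u N n * (poch a p n ^ 2 / poch p p n ^ 2 *
        (1 - (1 - u) ^ 2 * (2 - u) * ∑ i ∈ range n,
          (p * p ^ i / (1 - p * p ^ i) ^ 2 + a * p ^ i / (1 - a * p ^ i) ^ 2)))) +
      ((∑ k ∈ range (N + 1), baseTerm a p k * (pairRatio a p 1 k - pairRatio a p u k) ^ 2 *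
        (poch (a / u) p k / poch (p * u) p k * u ^ k)) +
      ∑ k ∈ range (N + 1), baseTerm a p k * (pairRatio a p 1 k - pairRatio a p u k) ^ 2 *
        (poch a p k / poch p p k - poch (a / u) p k / poch (p * u) p k * u ^ k)) := by
    -- This is x² = 2wx - w² + (x-w)², with x and w the pair ratios at 1 and at u; the square is
    -- then split along the last ratio.
    have e1 : ∑ k ∈ range (N + 1), vwpTerm a p k =
        (2 * ∑ k ∈ range (N + 1), baseTerm a p k * pairRatio a p u k * pairRatio a p 1 k *
          (poch a p k / poch p p k)) - (∑ k ∈ range (N + 1), baseTerm a p k * pairRatio a p u k *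
          pairRatio a p u k * (poch a p k / poch p p k)) +
      ((∑ k ∈ range (N + 1), baseTerm a p k * (pairRatio a p 1 k - pairRatio a p u k) ^ 2 *
        (poch (a / u) p k / poch (p * u) p k * u ^ k)) +
      ∑ k ∈ range (N + 1), baseTerm a p k * (pairRatio a p 1 k - pairRatio a p u k) ^ 2 *
        (poch a p k / poch p p k - poch (a / u) p k / poch (p * u) p k * u ^ k)) := by
      rw [mul_sum, ← sum_add_distrib, ← sum_sub_distrib, ← sum_add_distrib]
      exact sum_congr rfl fun k _ => by rw [vwpTerm_eq]; ring
    have e2 : ∑ n ∈ range (N + 1), balancedCoeff a p u N n *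
        (poch (a * u) p n * poch (a / u) p n *
          (2 / poch p p n ^ 2 - 1 / (poch (p * u) p n * poch (p / u) p n))) =
        (2 * ∑ n ∈ range (N + 1), balancedCoeff a p u N n *
          (poch (a * u) p n * poch (a / u) p n / (poch p p n * poch p p n))) -
        ∑ n ∈ range (N + 1), balancedCoeff a p u N n *
        (poch (a * u) p n * poch (a / u) p n / (poch (p * u) p n * poch (p / u) p n)) := by
      rw [mul_sum, ← sum_sub_distrib]
      exact sum_congr rfl fun k _ => by ring
    have e3 : (1 - u) * (a ^ N)⁻¹ * (poch (a ^ 2) p N / poch p p N) * ∑ n ∈ range (N + 1),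
        poch a p n ^ 3 * poch (p / a) p n * p ^ n / (poch p p n ^ 3 * poch (a ^ 2) p n) *
        (1 - (1 - u) ^ 2 * (2 - u) * ∑ i ∈ range n,
          (p * p ^ i / (1 - p * p ^ i) ^ 2 + a * p ^ i / (1 - a * p ^ i) ^ 2)) =
        ∑ n ∈ range (N + 1), balancedCoeff a p u N n * (poch a p n ^ 2 / poch p p n ^ 2 *
        (1 - (1 - u) ^ 2 * (2 - u) * ∑ i ∈ range n,
          (p * p ^ i / (1 - p * p ^ i) ^ 2 + a * p ^ i / (1 - a * p ^ i) ^ 2))) := by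
      rw [mul_sum]
      refine sum_congr rfl fun n hn => ?_
      have hn : n ≤ N := by simpa [Nat.lt_succ_iff] using hn
      have n1 : poch (a ^ 2) p n ≠ 0 := poch_ne_zero fun i hi => ha2 i (by omega)
      -- The prefactor (a²;p)_N absorbs each denominator (a²;p)_n, so the latter need only be
      -- nonzero, not a unit.
      have s : poch (a ^ 2) p N = poch (a ^ 2) p n * poch (a ^ 2 * p ^ n) p (N - n) := by
        rw [← poch_add]; congr 1; omega
      rw [s, balancedCoeff]
      generalize 1 - (1 - u) ^ 2 * (2 - u) * ∑ i ∈ range n,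
          (p * p ^ i / (1 - p * p ^ i) ^ 2 + a * p ^ i / (1 - a * p ^ i) ^ 2) = z
      generalize poch (a ^ 2) p n = w at *
      generalize poch (p / a) p n = w2 at *
      generalize (a ^ N)⁻¹ = w3 at *
      field_simp
    rw [e1, e2, e3, f1, fu]
    ring
  rw [e]
  exact v.map_add_le (h.val_balanced_comparison hc hcN hpc)
    (v.map_add_le (h.val_double_difference hc hcN hpc) h.val_triple_difference)

end LocalData

end Local
end QSeries

namespace QSeries

/-! ### Vanishing of blocks at a proper divisor of n. -/

section Blocks

variable {K : Type*} [Field K] {Γ : Type*} [LinearOrderedCommGroupWithZero Γ]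

/-- Isolates a factor independent of t. The other factor is the term of index t with p^(lm)
inserted, and p^(lm) is a one-unit when p has order m. -/
theorem vwpTerm_shift (a p : K) (m l t : ℕ) : vwpTerm a p (l * m + t) =
    ((poch a p (l * m) / poch p p (l * m)) ^ 6 * (p ^ 2 / a ^ 3) ^ (l * m)) *
      ((1 - a * (p ^ (l * m)) ^ 2 * p ^ (2 * t)) *
        (poch (a * p ^ (l * m)) p t * (poch (p * p ^ (l * m)) p t)⁻¹) ^ 6 *
          (p ^ 2 * (a ^ 3)⁻¹) ^ t) := by
  rw [vwpTerm, poch_add, poch_add]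
  generalize poch a p (l * m) = x1
  generalize poch p p (l * m) = x2
  rw [show p ^ (2 * (l * m + t)) = (p ^ (l * m)) ^ 2 * p ^ (2 * t) by ring, pow_add (p ^ 2 / a ^ 3)]
  simp only [div_eq_mul_inv, mul_inv]
  ring

/-- The situation at a prime where `p` has order `m` in the residue field and
`a p^s` is a one-unit. -/
structure BlockData (v : Valuation K Γ) (γ : Γ) (a p : K) (m s : ℕ) : Prop where
  val_p : v p = 1
  val_a : v a = 1
  lt_one : γ < 1
  lt : s < m
  val_P : ∀ i, i + 1 < m → v (1 - p ^ (i + 1)) = 1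
  near_P : v (1 - p ^ m) ≤ γ
  near_Q : v (1 - a * p ^ s) ≤ γ
  ne_zero : ∀ k, poch p p k ≠ 0
  regular : ∀ k, v (poch a p k) ≤ v (poch p p k)

namespace BlockData

variable {v : Valuation K Γ} {γ : Γ} {a p : K} {m s : ℕ} (h : BlockData v γ a p m s)
include h

theorem p_ne_zero : p ≠ 0 := fun h0 => by
  have := h.val_p
  simp [h0] at this

theorem near_pow (l : ℕ) : ModEq v γ (p ^ (l * m)) 1 := by
  have : ModEq v γ (p ^ m) 1 :=
    ⟨by simp [h.val_p], by simp, by rw [v.map_sub_swap]; exact h.near_P⟩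
  simpa [← pow_mul, mul_comm] using this.pow l

theorem modEq_a : ModEq v γ a (p ^ s)⁻¹ := by
  have hp := h.p_ne_zero
  refine ⟨h.val_a.le, by simp [h.val_p], ?_⟩
  rw [show a - (p ^ s)⁻¹ = -((p ^ s)⁻¹ * (1 - a * p ^ s)) by field_simp; ring, Valuation.map_neg,
    map_mul]
  simpa [h.val_p] using h.near_Q

theorem val_shift {i l : ℕ} (hi : i + 1 < m) : v (1 - p * p ^ (l * m) * p ^ i) = 1 := by
  refine valuation_eq_one_of_sub_lt (h.val_P i hi) (lt_of_le_of_lt ?_ h.lt_one)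
  rw [show 1 - p * p ^ (l * m) * p ^ i - (1 - p ^ (i + 1)) = -(p ^ (i + 1) * (p ^ (l * m) - 1)) by
    ring, Valuation.map_neg, map_mul]
  simpa [h.val_p] using (h.near_pow l).sub

theorem val_div_poch_le (k : ℕ) : v (poch a p k / poch p p k) ≤ 1 := by
  rw [map_div₀]
  exact div_le_one_of_le₀ (h.regular k) zero_le

theorem shift_modEq (l : ℕ) {t : ℕ} (ht : t < m) :
    ModEq v γ ((1 - a * (p ^ (l * m)) ^ 2 * p ^ (2 * t)) *
        (poch (a * p ^ (l * m)) p t * (poch (p * p ^ (l * m)) p t)⁻¹) ^ 6 *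
          (p ^ 2 * (a ^ 3)⁻¹) ^ t) (vwpTerm (p ^ s)⁻¹ p t) := by
  have ha := h.modEq_a
  have hl := h.near_pow l
  have vp : ∀ n : ℕ, v (p ^ n) ≤ 1 := fun n => by simp [h.val_p]
  have M1 := ha.mul hl
  rw [mul_one] at M1
  have M2 := ha.mul (hl.pow 2)
  rw [one_pow, mul_one] at M2
  have M3 := (ModEq.refl (γ := γ) h.val_p.le).mul hl
  rw [mul_one] at M3
  rw [vwpTerm, div_eq_mul_inv, div_eq_mul_inv]
  refine (((ModEq.refl (by simp)).sub' (M2.mul (ModEq.refl (vp _)))).mul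
    (((M1.poch h.val_p.le t).mul ((M3.poch h.val_p.le t).inv ?_ ?_)).pow 6)).mul
    (((ModEq.refl (vp 2)).mul ((ha.pow 3).inv ?_ ?_)).pow t)
  · exact valuation_poch_eq_one fun i hi => h.val_shift (by omega)
  · exact valuation_poch_eq_one fun i hi => by rw [← pow_succ']; exact h.val_P i (by omega)
  · simp [h.val_a]
  · simp [h.val_p]

theorem vwpTerm_eq_zero {t : ℕ} (ht : s < t) : vwpTerm (p ^ s)⁻¹ p t = 0 := by
  have : poch (p ^ s)⁻¹ p t = 0 := by
    rw [poch, prod_eq_zero (mem_range.2 ht)]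
    rw [inv_mul_cancel₀ (pow_ne_zero _ h.p_ne_zero), sub_self]
  simp [vwpTerm, this]

/-- Modulo γ, a = p^(-s) and p^m = 1, so the block is an integral constant times a series that stops
at index s and vanishes by antisymmetry. Hence it may be cut anywhere after s. -/
theorem val_block [CharZero K] (l : ℕ) {t : ℕ} (hs : s < t) (ht : t ≤ m) :
    v (∑ i ∈ range t, vwpTerm a p (l * m + i)) ≤ γ := by
  rw [sum_congr rfl fun i _ => vwpTerm_shift a p m l i, ← mul_sum, map_mul]
  refine mul_le_of_le_one_of_le ?_ ?_
  · rw [map_mul, map_pow, map_pow]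
    refine mul_le_one' (pow_le_one' (h.val_div_poch_le _) _) (pow_le_one' ?_ _)
    simp [h.val_p, h.val_a]
  · have M := (ModEq.sum (s := range t) fun i hi => h.shift_modEq l
      (show i < m by have := mem_range.1 hi; omega)).sub
    have hP : ∀ i < s, 1 - p ^ (i + 1) ≠ 0 := fun i hi =>
      LocalData.ne_zero_of_val (h.val_P i (by have := h.lt; omega))
    have Z := sum_vwpTerm_mul_eq_zero (b := (p ^ s)⁻¹) h.p_ne_zero
      (inv_mul_cancel₀ (pow_ne_zero _ h.p_ne_zero)) hP (fun _ => 1) (fun _ _ => rfl)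
    simp only [mul_one] at Z
    rw [← sum_subset (s₁ := range (s + 1)) (s₂ := range t) (by
      intro i hi; simp only [mem_range] at *; omega) (fun i _ hi => h.vwpTerm_eq_zero (by
        simp only [mem_range] at hi; omega)), Z, sub_zero] at M
    exact M

theorem val_sum_blocks [CharZero K] (l : ℕ) : v (∑ k ∈ range (l * m), vwpTerm a p k) ≤ γ := by
  induction l with
  | zero => simp
  | succ l ih =>
    rw [add_mul, one_mul, sum_range_add]
    exact v.map_add_le ih (h.val_block l h.lt le_rfl)

theorem val_sum_blocks_add [CharZero K] (l : ℕ) :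
    v (∑ k ∈ range (l * m + (s + 1)), vwpTerm a p k) ≤ γ := by
  rw [sum_range_add]
  exact v.map_add_le (h.val_sum_blocks l) (h.val_block l (Nat.lt_succ_self s) h.lt)

end BlockData

end Blocks
end QSeries

noncomputable section
namespace QSeries

/-! ### Valuations at the cyclotomic polynomials. -/

section Cyclotomic

open Polynomial

/-- The valuation of `ℚ(q)` attached to the cyclotomic polynomial `Φ_m`. -/
def cycSpectrum (m : ℕ) (hm : 0 < m) : IsDedekindDomain.HeightOneSpectrum ℚ[X] where
  asIdeal := Ideal.span {cyclotomic m ℚ}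
  isPrime := (Ideal.span_singleton_prime (cyclotomic_ne_zero m ℚ)).2
    (cyclotomic.irreducible_rat hm).prime
  ne_bot := by simpa using cyclotomic_ne_zero m ℚ

def cycVal (m : ℕ) (hm : 0 < m) : Valuation (RatFunc ℚ) (WithZero (Multiplicative ℤ)) :=
  (cycSpectrum m hm).valuation (RatFunc ℚ)

/-- The valuation of a uniformizer. -/
def unif : WithZero (Multiplicative ℤ) := WithZero.exp (-1)

theorem unif_lt_one : unif < 1 := by
  rw [unif, ← WithZero.exp_zero]; exact WithZero.exp_lt_exp.2 (by norm_num)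

theorem unif_ne_zero : unif ≠ 0 := WithZero.exp_ne_zero

theorem unif_pow (k : ℕ) : unif ^ k = WithZero.exp (-(k : ℤ)) := by
  rw [unif, ← WithZero.exp_nsmul]; simp

section

variable {m : ℕ} (hm : 0 < m)

theorem cycVal_le_pow_iff (f : ℚ[X]) (k : ℕ) :
    cycVal m hm (algebraMap ℚ[X] (RatFunc ℚ) f) ≤ unif ^ k ↔ cyclotomic m ℚ ^ k ∣ f := by
  rw [cycVal, IsDedekindDomain.HeightOneSpectrum.valuation_of_algebraMap, unif_pow,
    IsDedekindDomain.HeightOneSpectrum.intValuation_le_pow_iff_dvd, cycSpectrum,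
    Ideal.span_singleton_pow, Ideal.dvd_span_singleton, Ideal.mem_span_singleton]

theorem cycVal_le_one (f : ℚ[X]) : cycVal m hm (algebraMap ℚ[X] (RatFunc ℚ) f) ≤ 1 := by
  simpa using (cycVal_le_pow_iff hm f 0).2 (by simp)

theorem cycVal_eq_one (f : ℚ[X]) (hf : ¬ cyclotomic m ℚ ∣ f) :
    cycVal m hm (algebraMap ℚ[X] (RatFunc ℚ) f) = 1 := by
  refine (cycVal_le_one hm f).antisymm (not_lt.1 fun hlt => hf ?_)
  rw [cycVal, IsDedekindDomain.HeightOneSpectrum.valuation_of_algebraMap,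
    IsDedekindDomain.HeightOneSpectrum.intValuation_lt_one_iff_dvd, cycSpectrum,
    Ideal.dvd_span_singleton, Ideal.mem_span_singleton] at hlt
  exact hlt

theorem cycVal_cyclotomic_self :
    cycVal m hm (algebraMap ℚ[X] (RatFunc ℚ) (cyclotomic m ℚ)) = unif := by
  rw [cycVal, IsDedekindDomain.HeightOneSpectrum.valuation_of_algebraMap]
  exact IsDedekindDomain.HeightOneSpectrum.intValuation_singleton _ (cyclotomic_ne_zero m ℚ) rfl

theorem cycVal_cyclotomic_of_ne {e : ℕ} (hne : e ≠ m) :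
    cycVal m hm (algebraMap ℚ[X] (RatFunc ℚ) (cyclotomic e ℚ)) = 1 := by
  refine cycVal_eq_one hm _ fun hd => ?_
  have := (cyclotomic.isCoprime_rat hne).isUnit_of_dvd' hd dvd_rfl
  exact (cyclotomic.irreducible_rat hm).not_isUnit this

/-- q^j - 1 is the product of the Φ_e with e ∣ j, each occurring once. -/
theorem cycVal_q_pow_sub_one {j : ℕ} (hj : 0 < j) :
    cycVal m hm (q ^ j - 1) = if m ∣ j then unif else 1 := by
  have e : (q ^ j - 1 : RatFunc ℚ) = algebraMap ℚ[X] (RatFunc ℚ) (X ^ j - 1) := by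
    rw [map_sub, map_pow, map_one, RatFunc.algebraMap_X]
  rw [e, ← prod_cyclotomic_eq_X_pow_sub_one hj, map_prod, map_prod]
  split_ifs with h
  · have hmem : m ∈ j.divisors := Nat.mem_divisors.2 ⟨h, hj.ne'⟩
    rw [← mul_prod_erase _ _ hmem, cycVal_cyclotomic_self, prod_eq_one, mul_one]
    intro e he
    rw [mem_erase] at he
    exact cycVal_cyclotomic_of_ne hm he.1
  · refine prod_eq_one fun e he => cycVal_cyclotomic_of_ne hm ?_
    rintro rfl
    exact h (Nat.dvd_of_mem_divisors he)

theorem cycVal_q : cycVal m hm q = 1 := by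
  rw [show (q : RatFunc ℚ) = algebraMap ℚ[X] (RatFunc ℚ) X from (RatFunc.algebraMap_X).symm]
  refine cycVal_eq_one hm _ fun hd => ?_
  have h1 : cyclotomic m ℚ ∣ X ^ m - 1 := cyclotomic.dvd_X_pow_sub_one m ℚ
  have h2 : cyclotomic m ℚ ∣ 1 := by
    have := (hd.trans (dvd_pow_self X hm.ne')).sub h1
    simpa using this
  exact (cyclotomic.irreducible_rat hm).not_isUnit (isUnit_of_dvd_one h2)

theorem q_ne_zero : (q : RatFunc ℚ) ≠ 0 := RatFunc.X_ne_zero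

theorem cycVal_q_zpow (j : ℤ) : cycVal m hm (q ^ j) = 1 := by
  rw [map_zpow₀, cycVal_q, one_zpow]

theorem cycVal_one_sub_q_zpow {j : ℤ} (hj : j ≠ 0) :
    cycVal m hm (1 - q ^ j) = if (m : ℤ) ∣ j then unif else 1 := by
  obtain ⟨k, rfl | rfl⟩ := j.eq_nat_or_neg
  · rw [Valuation.map_sub_swap, zpow_natCast, cycVal_q_pow_sub_one hm (by omega)]
    simp only [Int.natCast_dvd_natCast]
  · have hk : (q : RatFunc ℚ) ^ k ≠ 0 := pow_ne_zero _ q_ne_zero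
    have e : (1 - q ^ (-(k : ℤ)) : RatFunc ℚ) = q ^ (-(k : ℤ)) * (q ^ k - 1) := by
      rw [zpow_neg, zpow_natCast]; field_simp
    rw [e, map_mul, cycVal_q_zpow, one_mul, cycVal_q_pow_sub_one hm (by omega)]
    simp only [dvd_neg, Int.natCast_dvd_natCast]

theorem cycVal_one_sub_q_zpow_le {j : ℤ} (hj : (m : ℤ) ∣ j) : cycVal m hm (1 - q ^ j) ≤ unif := by
  rcases eq_or_ne j 0 with rfl | h0
  · simp
  · rw [cycVal_one_sub_q_zpow hm h0, if_pos hj]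

theorem cycVal_one_sub_q_zpow_eq_one {j : ℤ} (hj : ¬ (m : ℤ) ∣ j) :
    cycVal m hm (1 - q ^ j) = 1 := by
  rw [cycVal_one_sub_q_zpow hm (by rintro rfl; simp at hj), if_neg hj]

theorem unif_le_cycVal_one_sub_q_zpow {j : ℤ} (hj : j ≠ 0) :
    unif ≤ cycVal m hm (1 - q ^ j) := by
  rw [cycVal_one_sub_q_zpow hm hj]
  split_ifs
  exacts [le_rfl, unif_lt_one.le]

theorem one_sub_q_zpow_ne_zero {j : ℤ} (hj : j ≠ 0) : (1 - q ^ j : RatFunc ℚ) ≠ 0 := fun h => by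
  have := unif_le_cycVal_one_sub_q_zpow Nat.one_pos hj
  rw [h, map_zero] at this
  exact unif_ne_zero (le_antisymm this zero_le)

end

/-- A congruence modulo `[n] Φ_n(q)^5` can be checked one cyclotomic valuation at a time. -/
theorem ratCongr_modulus {n : ℕ} (hn : 1 < n) {A B : RatFunc ℚ}
    (htop : cycVal n (by omega) (A - B) ≤ unif ^ 6)
    (hdiv : ∀ m (hm : 1 < m), m ∣ n → m < n → cycVal m (by omega) (A - B) ≤ unif) :
    RatCongr (modulus n) A B := by
  set D := A - B with hD
  -- In lowest terms, an integral valuation keeps Φ_m out of the denominator, so all of the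
  -- valuation is carried by the numerator.
  have local_dvd : ∀ m (hm : 0 < m) (k : ℕ), cycVal m hm D ≤ unif ^ k →
      cyclotomic m ℚ ^ k ∣ D.num ∧ ¬ cyclotomic m ℚ ∣ D.denom := by
    intro m hm k hk
    have hirr := cyclotomic.irreducible_rat hm
    have hle : cycVal m hm D ≤ 1 := hk.trans (pow_le_one' unif_lt_one.le k)
    have hden : algebraMap ℚ[X] (RatFunc ℚ) D.denom ≠ 0 :=
      RatFunc.algebraMap_ne_zero D.denom_ne_zero
    have hmul : cycVal m hm (algebraMap ℚ[X] (RatFunc ℚ) D.num) =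
        cycVal m hm D * cycVal m hm (algebraMap ℚ[X] (RatFunc ℚ) D.denom) := by
      rw [← map_mul]
      rw [(eq_div_iff hden).1 (RatFunc.num_div_denom D).symm]
    have h2 : ¬ cyclotomic m ℚ ∣ D.denom := by
      intro hd
      have hnum : cyclotomic m ℚ ∣ D.num := by
        rw [← pow_one (cyclotomic m ℚ), ← cycVal_le_pow_iff hm, hmul]
        rw [← pow_one (cyclotomic m ℚ), ← cycVal_le_pow_iff hm] at hd
        exact mul_le_of_le_one_of_le hle hd
      exact hirr.not_isUnit ((RatFunc.isCoprime_num_denom D).isUnit_of_dvd' hnum hd)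
    refine ⟨?_, h2⟩
    rw [← cycVal_le_pow_iff hm, hmul, cycVal_eq_one hm _ h2, mul_one]
    exact hk
  let ex : ℕ → ℕ := fun m => if m = n then 6 else 1
  have hmod : modulus n = ∏ m ∈ n.divisors.erase 1, cyclotomic m ℚ ^ ex m := by
    have hmem : n ∈ n.divisors.erase 1 := by simp; omega
    rw [modulus, qIntPoly, ← prod_cyclotomic_eq_geom_sum (by omega), ← mul_prod_erase _ _ hmem,
      ← mul_prod_erase _ (fun m => cyclotomic m ℚ ^ ex m) hmem]
    have : ∏ m ∈ (n.divisors.erase 1).erase n, cyclotomic m ℚ ^ ex m =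
        ∏ m ∈ (n.divisors.erase 1).erase n, cyclotomic m ℚ :=
      prod_congr rfl fun m hm => by
        have := (mem_erase.1 hm).1
        simp [ex, this]
    rw [this]
    simp only [ex, if_true]
    ring
  have hall : ∀ m ∈ n.divisors.erase 1,
      cyclotomic m ℚ ^ ex m ∣ D.num ∧ ¬ cyclotomic m ℚ ∣ D.denom := by
    intro m hm
    rw [mem_erase, Nat.mem_divisors] at hm
    obtain ⟨h1, hdvd, hn0⟩ := hm
    have hpos : 0 < m := Nat.pos_of_dvd_of_pos hdvd (by omega)
    refine local_dvd m hpos _ ?_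
    by_cases hmn : m = n
    · subst hmn; simpa [ex] using htop
    · simpa [ex, hmn] using hdiv m (by omega) hdvd
        (lt_of_le_of_ne (Nat.le_of_dvd (by omega) hdvd) hmn)
  have hdvd : modulus n ∣ D.num := by
    rw [hmod]
    refine Finset.prod_dvd_of_coprime ?_ fun m hm => (hall m hm).1
    intro i _ j _ hij
    exact (cyclotomic.isCoprime_rat hij).pow
  obtain ⟨w, hw⟩ := hdvd
  refine ⟨w, D.denom, ?_, ?_⟩
  · rw [hmod]
    refine IsCoprime.prod_right fun m hm => IsCoprime.pow_right ?_
    have hpos : 0 < m := Nat.pos_of_mem_divisors (mem_of_mem_erase hm)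
    exact ((cyclotomic.irreducible_rat hpos).coprime_iff_not_dvd.2 (hall m hm).2).symm
  · rw [← hw, RatFunc.num_div_denom]

end Cyclotomic

end QSeries
end

namespace QSeries

/-! ### Translation of both sides into `vwpTerm` and `mainSide`. -/

theorem zpow_mul_pow (s : ℤ) (d i : ℕ) : (q ^ s * (q ^ d) ^ i : RatFunc ℚ) = q ^ (s + d * i) := by
  rw [zpow_add₀ q_ne_zero, ← pow_mul, ← zpow_natCast q (d * i)]; push_cast; rfl

theorem pow_pow_eq_zpow (d i : ℕ) : ((q ^ d) ^ i : RatFunc ℚ) = q ^ ((d : ℤ) * i) := by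
  rw [← pow_mul, ← zpow_natCast q (d * i)]; push_cast; rfl

theorem pow_mul_pow_eq_zpow (d i : ℕ) :
    (q ^ d * (q ^ d) ^ i : RatFunc ℚ) = q ^ ((d : ℤ) * (i + 1 : ℕ)) := by
  rw [← pow_succ', pow_pow_eq_zpow]

/-- The main form of the right-hand side, without the factor `1 / (1 - q)`. -/
def mainSide {K : Type*} [Field K] (a p u : K) (N : ℕ) : K :=
  (1 - u) * (a ^ N)⁻¹ * (poch (a ^ 2) p N / poch p p N) * ∑ n ∈ range (N + 1),
    poch a p n ^ 3 * poch (p / a) p n * p ^ n / (poch p p n ^ 3 * poch (a ^ 2) p n) *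
    (1 - (1 - u) ^ 2 * (2 - u) * ∑ i ∈ range n,
      (p * p ^ i / (1 - p * p ^ i) ^ 2 + a * p ^ i / (1 - a * p ^ i) ^ 2))

theorem lhsSum_eq (d : ℕ) (r : ℤ) (M : ℕ) :
    lhsSum d r M = (1 - q)⁻¹ * ∑ k ∈ range (M + 1), vwpTerm (q ^ r) (q ^ d : RatFunc ℚ) k := by
  rw [lhsSum, mul_sum]
  refine sum_congr rfl fun k _ => ?_
  have hq := q_ne_zero
  have e1 : (q ^ (2 * (d : ℤ) * k + r) : RatFunc ℚ) = q ^ r * (q ^ d) ^ (2 * k) := by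
    rw [zpow_mul_pow]; congr 1; push_cast; ring
  have e2 : (q ^ ((2 * (d : ℤ) - 3 * r) * k) : RatFunc ℚ) = ((q ^ d) ^ 2 / (q ^ r) ^ 3) ^ k := by
    have h2 : (q ^ (2 * (d : ℤ)) : RatFunc ℚ) = (q ^ d) ^ 2 := by
      rw [← pow_mul, mul_comm d 2]; norm_cast
    have h3 : (q ^ (3 * r) : RatFunc ℚ) = (q ^ r) ^ 3 := by
      rw [mul_comm, zpow_mul]; norm_cast
    rw [zpow_mul, zpow_natCast, zpow_sub₀ hq, h2, h3]
  rw [qInt, e1, e2, vwpTerm, div_pow]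
  change _ / _ * (poch _ _ k ^ 6 / poch _ _ k ^ 6) * _ = _
  rw [div_eq_mul_inv (1 - _)]
  ring

theorem innerSum_eq (d : ℕ) (r : ℤ) (k : ℕ) :
    innerSum d r k = (1 - q) ^ 2 * ∑ i ∈ range k,
      (q ^ d * (q ^ d) ^ i / (1 - q ^ d * (q ^ d) ^ i) ^ 2 +
        q ^ r * (q ^ d) ^ i / (1 - q ^ r * (q ^ d) ^ i) ^ 2 : RatFunc ℚ) := by
  induction k with
  | zero => simp [innerSum]
  | succ k ih =>
    have e1 : (q ^ ((d : ℤ) * (k + 1 : ℕ)) : RatFunc ℚ) = q ^ d * (q ^ d) ^ k :=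
      (pow_mul_pow_eq_zpow d k).symm
    have e2 : (q ^ ((d : ℤ) * (k + 1 : ℕ) - d + r) : RatFunc ℚ) = q ^ r * (q ^ d) ^ k := by
      rw [zpow_mul_pow]; congr 1; push_cast; ring
    rw [innerSum] at ih ⊢
    rw [sum_Icc_succ_top (by omega), ih, sum_range_succ, mul_add]
    congr 1
    rw [qInt, qInt, e1, e2, div_pow, div_pow, div_div_eq_mul_div, div_div_eq_mul_div]
    ring

theorem rhs_eq {n d : ℕ} {r : ℤ} (hN : (d : ℤ) * (topIndex n d r : ℤ) = (d : ℤ) * n - n - r)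
    (hd : 0 < d) :
    qInt (d * n - n) * q ^ (r * (r + n - d * n) / d)
        * (qPoch (q ^ (2 * r)) (q ^ d) (topIndex n d r)
            / qPoch (q ^ d) (q ^ d) (topIndex n d r))
        * ∑ k ∈ Finset.range (topIndex n d r + 1),
            (qPoch (q ^ r) (q ^ d) k ^ 3 * qPoch (q ^ ((d : ℤ) - r)) (q ^ d) k
                * q ^ ((d : ℤ) * k))
              / (qPoch (q ^ d) (q ^ d) k ^ 3 * qPoch (q ^ (2 * r)) (q ^ d) k)
            * (1 - qInt (d * n - n) ^ 2 * (2 - q ^ ((d : ℤ) * n - n)) * innerSum d r k) =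
      (1 - q)⁻¹ * mainSide (q ^ r) (q ^ d) (q ^ ((d : ℤ) * n - n)) (topIndex n d r) := by
  have hq := q_ne_zero
  have h1q := one_sub_q_ne_zero
  -- The integer division is exact: the numerator is -d r N.
  have e1 : (q ^ (r * (r + n - d * n) / d) : RatFunc ℚ) = ((q ^ r) ^ topIndex n d r)⁻¹ := by
    rw [show r * (r + n - d * n) = d * (-(r * topIndex n d r)) by
      linear_combination r * hN, Int.mul_ediv_cancel_left _ (by positivity), zpow_neg, zpow_mul,
      zpow_natCast]
  have e2 : (q ^ (2 * r) : RatFunc ℚ) = (q ^ r) ^ 2 := by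
    rw [mul_comm, zpow_mul]; norm_cast
  have e3 : (q ^ ((d : ℤ) - r) : RatFunc ℚ) = q ^ d / q ^ r := by
    rw [zpow_sub₀ hq, zpow_natCast]
  have e4 : ∀ k, qInt (d * n - n) ^ 2 * (2 - q ^ ((d : ℤ) * n - n)) * innerSum d r k =
      (1 - q ^ ((d : ℤ) * n - n)) ^ 2 * (2 - q ^ ((d : ℤ) * n - n)) * ∑ i ∈ range k,
      (q ^ d * (q ^ d) ^ i / (1 - q ^ d * (q ^ d) ^ i) ^ 2 +
        q ^ r * (q ^ d) ^ i / (1 - q ^ r * (q ^ d) ^ i) ^ 2 : RatFunc ℚ) := by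
    intro k
    rw [innerSum_eq, qInt]
    generalize ∑ i ∈ range k, (_ : RatFunc ℚ) = S
    field_simp
  rw [mainSide, e1, e2, e3, qInt, ← qInt]
  simp only [e4, ← pow_pow_eq_zpow]
  change _ * _ * (poch _ _ _ / poch _ _ _) * (∑ k ∈ range _, poch _ _ k ^ 3 * poch _ _ k * _ /
    (poch _ _ k ^ 3 * poch _ _ k) * _) = _
  rw [qInt, div_eq_mul_inv (1 - _)]
  ring

/-! ### Counting factors Φ_m in q-shifted factorials. -/

section Counting

variable {m d : ℕ} (hm : 0 < m) (hmd : IsCoprime (m : ℤ) (d : ℤ))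

include hm hmd in
theorem exists_dvd_add_mul (s : ℤ) : ∃ i < m, (m : ℤ) ∣ s + d * i := by
  obtain ⟨x, y, hxy⟩ := hmd
  have hm' : (0 : ℤ) < m := by exact_mod_cast hm
  have h0 := Int.emod_nonneg (-s * y) hm'.ne'
  have h1 := Int.emod_lt_of_pos (-s * y) hm'
  refine ⟨((-s * y) % m).toNat, by omega, ?_⟩
  rw [Int.toNat_of_nonneg h0]
  have h2 := Int.mul_ediv_add_emod (-s * y) m
  refine ⟨s * x - d * (-s * y / m), ?_⟩
  linear_combination (-s) * hxy + d * h2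

include hmd in
-- As m and d are coprime, every m consecutive factors include one divisible by Φ_m.
theorem cycVal_poch_mul_le (s : ℤ) (l : ℕ) :
    cycVal m hm (poch (q ^ s) (q ^ d) (l * m)) ≤ unif ^ l := by
  have hp : cycVal m hm (q ^ d) ≤ 1 := by simp [cycVal_q]
  induction l with
  | zero => simp
  | succ l ih =>
    rw [add_mul, one_mul, poch_add, map_mul, pow_succ]
    refine mul_le_mul' ih ?_
    rw [zpow_mul_pow]
    obtain ⟨i, hi, hdvd⟩ := exists_dvd_add_mul hm hmd (s + d * (l * m : ℕ))
    refine valuation_poch_le_of_factor (i := i) (cycVal_q_zpow hm _).le hp hi ?_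
    rw [zpow_mul_pow]
    exact cycVal_one_sub_q_zpow_le hm hdvd

include hmd in
theorem cycVal_poch_le (s : ℤ) (k : ℕ) :
    cycVal m hm (poch (q ^ s) (q ^ d) k) ≤ unif ^ (k / m) := by
  have hp : cycVal m hm (q ^ d) ≤ 1 := by simp [cycVal_q]
  conv_lhs => rw [← Nat.div_add_mod' k m, poch_add, map_mul]
  refine mul_le_of_le_of_le_one (cycVal_poch_mul_le hm hmd s _) ?_
  rw [zpow_mul_pow]
  exact valuation_poch_le_one (cycVal_q_zpow hm _).le hp _

include hmd in
-- The incomplete last period gives one factor more when it extends past the residue t where Φ_m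
-- divides.
theorem cycVal_poch_le_of_lt {s : ℤ} {t k : ℕ} (ht : (m : ℤ) ∣ s + d * t) (htk : t < k % m) :
    cycVal m hm (poch (q ^ s) (q ^ d) k) ≤ unif ^ (k / m + 1) := by
  have hp : cycVal m hm (q ^ d) ≤ 1 := by simp [cycVal_q]
  conv_lhs => rw [← Nat.div_add_mod' k m, poch_add, map_mul]
  rw [pow_succ]
  refine mul_le_mul' (cycVal_poch_mul_le hm hmd s _) ?_
  rw [zpow_mul_pow]
  refine valuation_poch_le_of_factor (i := t) (cycVal_q_zpow hm _).le hp htk ?_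
  rw [zpow_mul_pow]
  refine cycVal_one_sub_q_zpow_le hm ?_
  obtain ⟨w, hw⟩ := ht
  exact ⟨w + d * (k / m : ℕ), by push_cast; linear_combination hw⟩

include hmd in
theorem dvd_mul_iff (j : ℕ) : (m : ℤ) ∣ d * j ↔ m ∣ j := by
  rw [← Int.natCast_dvd_natCast]
  exact ⟨hmd.dvd_of_dvd_mul_left, fun h => h.mul_left _⟩

include hmd in
theorem cycVal_poch_self (hd : 0 < d) (k : ℕ) :
    cycVal m hm (poch (q ^ d) (q ^ d) k) = unif ^ (k / m) := by
  induction k with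
  | zero => simp
  | succ k ih =>
    have : (d : ℤ) * (k + 1 : ℕ) ≠ 0 := by positivity
    rw [poch_succ, map_mul, ih, pow_mul_pow_eq_zpow, cycVal_one_sub_q_zpow hm this,
      Nat.succ_div, pow_add]
    simp only [dvd_mul_iff hmd]
    split_ifs <;> simp

end Counting

/-! ### Both sides at Φ_n and at the proper divisors of n. -/

section Main

theorem ne_zero_of_three_le {d : ℕ} {r : ℤ} (hr : r = 1 ∨ r = -1) (hd : 3 ≤ d) (i : ℕ) :
    r + (d : ℤ) * i ≠ 0 ∧ 2 * r + (d : ℤ) * i ≠ 0 := by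
  rcases i with _ | i
  · rcases hr with rfl | rfl <;> simp
  · have : (d : ℤ) ≤ d * (i + 1 : ℕ) := by push_cast; nlinarith
    constructor <;> rcases hr with rfl | rfl <;> omega

variable {n d : ℕ} {r : ℤ}

/-- The local data at `Φ_n`. -/
theorem localData_cyclotomic (hn : 0 < n) {N c : ℕ} (hd : 3 ≤ d)
    (hcop : IsCoprime (n : ℤ) (d : ℤ)) (hN : (d : ℤ) * N = d * n - n - r) (hNc : N + c = n)
    (hc : 1 ≤ c) (hN1 : 1 ≤ N) :
    LocalData (cycVal n hn) unif (q ^ r) (q ^ d) (q ^ ((d : ℤ) * n - n)) N where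
  top := by rw [zpow_mul_pow, hN]; congr 1; ring
  val_p := by simp [cycVal_q]
  lt_one := unif_lt_one
  near := cycVal_one_sub_q_zpow_le hn ⟨d - 1, by ring⟩
  ne_one := by
    refine fun h => one_sub_q_zpow_ne_zero (j := (d : ℤ) * n - n) ?_ (sub_eq_zero.2 h.symm)
    have : (3 : ℤ) ≤ d := by exact_mod_cast hd
    have : (1 : ℤ) ≤ n := by exact_mod_cast hn
    nlinarith
  pos := hN1
  val_P := fun i hi => by
    rw [pow_pow_eq_zpow]
    refine cycVal_one_sub_q_zpow_eq_one hn ?_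
    rw [dvd_mul_iff hcop]
    exact Nat.not_dvd_of_pos_of_lt (by omega) (by omega)

theorem top_congruence (hn : 0 < n) {N c : ℕ} (hr : r = 1 ∨ r = -1) (hd : 3 ≤ d)
    (hcop : IsCoprime (n : ℤ) (d : ℤ)) (hN : (d : ℤ) * N = d * n - n - r) (hNc : N + c = n)
    (hc : 1 ≤ c) (hcN : 2 * c ≤ N + 1) {M : ℕ} (hM : M = N ∨ M = n - 1) :
    cycVal n hn (∑ k ∈ range (M + 1), vwpTerm (q ^ r) (q ^ d) k -
      mainSide (q ^ r) (q ^ d) (q ^ ((d : ℤ) * n - n)) N) ≤ unif ^ 6 := by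
  have L := localData_cyclotomic hn hd hcop hN hNc hc (by omega)
  have main := L.main_congruence hc hcN (by
      rw [hNc, pow_pow_eq_zpow]
      exact cycVal_one_sub_q_zpow_le hn ⟨d, by ring⟩) (by
      intro i _
      rw [← zpow_natCast, ← zpow_mul, zpow_mul_pow]
      refine one_sub_q_zpow_ne_zero ?_
      rw [mul_comm]
      exact (ne_zero_of_three_le hr hd i).2)
  rcases hM with rfl | rfl
  · exact main
  -- For N < k < n the numerator contains (1-u)^6 while (q^d;q^d)_k is still a unit, so the extra
  -- terms are negligible.
  · obtain ⟨e, rfl⟩ : ∃ e, c = e + 1 := ⟨c - 1, by omega⟩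
    rw [show n - 1 + 1 = (N + 1) + e by omega, sum_range_add, add_sub_right_comm]
    refine Valuation.map_add_le _ main (Valuation.map_sum_le _ fun i hi => ?_)
    have hi := mem_range.1 hi
    have hp : cycVal n hn (q ^ d) = 1 := by simp [cycVal_q]
    have ha : cycVal n hn (q ^ r) = 1 := cycVal_q_zpow hn r
    have h1 : cycVal n hn (poch (q ^ r) (q ^ d) (N + 1 + i)) ≤ unif :=
      valuation_poch_le_of_factor (i := N) ha.le hp.le (by omega) (by rw [L.top]; exact L.near)
    have h2 : cycVal n hn (poch (q ^ d) (q ^ d) (N + 1 + i)) = 1 := by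
      rw [cycVal_poch_self hn hcop (by omega), Nat.div_eq_of_lt (by omega), pow_zero]
    rw [vwpTerm, map_mul, map_mul]
    refine mul_le_of_le_of_le_one (mul_le_of_le_one_of_le ?_ ?_) ?_
    · exact Valuation.map_sub_le _ (by simp) (by simp [ha, cycVal_q])
    · rw [map_pow, map_div₀, h2, div_one]
      exact pow_le_pow_left' h1 6
    · simp [ha, cycVal_q]

theorem blockData_cyclotomic {m : ℕ} (hm : 1 < m) (hd : 3 ≤ d) {N : ℕ}
    (hcop : IsCoprime (m : ℤ) (d : ℤ)) (hN : (m : ℤ) ∣ r + d * N) :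
    BlockData (cycVal m (by omega)) unif (q ^ r) (q ^ d) m (N % m) := by
  have hmod : (m : ℤ) ∣ r + d * (N % m : ℕ) := by
    obtain ⟨w, hw⟩ := hN
    have := Nat.div_add_mod N m
    refine ⟨w - d * (N / m : ℕ), ?_⟩
    have h2 : (m : ℤ) * (N / m : ℕ) + (N % m : ℕ) = N := by exact_mod_cast this
    linear_combination hw + d * h2
  exact {
    val_p := by simp [cycVal_q]
    val_a := cycVal_q_zpow _ r
    lt_one := unif_lt_one
    lt := Nat.mod_lt _ (by omega)
    val_P := fun i hi => by
      rw [pow_pow_eq_zpow]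
      refine cycVal_one_sub_q_zpow_eq_one _ ?_
      rw [dvd_mul_iff hcop]
      exact Nat.not_dvd_of_pos_of_lt (by omega) hi
    near_P := by
      rw [pow_pow_eq_zpow]
      exact cycVal_one_sub_q_zpow_le _ ⟨d, by ring⟩
    near_Q := by
      rw [zpow_mul_pow]
      exact cycVal_one_sub_q_zpow_le _ hmod
    ne_zero := fun k => poch_ne_zero fun i _ => by
      rw [pow_mul_pow_eq_zpow]
      exact one_sub_q_zpow_ne_zero (by positivity)
    regular := fun k => by
      rw [cycVal_poch_self _ hcop (by omega)]
      exact cycVal_poch_le _ hcop r k }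

/-- For M = n-1 the range consists of complete blocks. For M = N the last block ends exactly at s =
N mod m, where its sum already vanishes. -/
theorem lhs_congruence_of_dvd {m : ℕ} (hm : 1 < m) (hmn : m ∣ n) (hd : 3 ≤ d)
    {N : ℕ} (hn : 0 < n) (hcop : IsCoprime (m : ℤ) (d : ℤ)) (hN : (d : ℤ) * N = d * n - n - r)
    {M : ℕ} (hM : M = N ∨ M = n - 1) :
    cycVal m (by omega) (∑ k ∈ range (M + 1), vwpTerm (q ^ r) (q ^ d) k) ≤ unif := by
  have B := blockData_cyclotomic (r := r) (N := N) hm hd hcop (by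
    obtain ⟨w, rfl⟩ := hmn
    exact ⟨(d - 1) * w, by rw [hN]; push_cast; ring⟩)
  rcases hM with rfl | rfl
  · have := B.val_sum_blocks_add (M / m)
    rwa [← add_assoc, Nat.div_add_mod'] at this
  · have := B.val_sum_blocks (n / m)
    rwa [Nat.div_mul_cancel hmn, ← Nat.sub_add_cancel (show 1 ≤ n from hn)] at this

/-- Each 1 - q^j with j ≠ 0 contains Φ_m at most once, so (1-u)² cancels the double poles of the
inner sum. -/
theorem bracket_le_one {m : ℕ} (hm : 0 < m) (hr : r = 1 ∨ r = -1) (hd : 3 ≤ d) (hmn : m ∣ n)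
    (k : ℕ) :
    cycVal m hm (1 - (1 - q ^ ((d : ℤ) * n - n)) ^ 2 * (2 - q ^ ((d : ℤ) * n - n)) *
      ∑ i ∈ range k, (q ^ d * (q ^ d) ^ i / (1 - q ^ d * (q ^ d) ^ i) ^ 2 +
        q ^ r * (q ^ d) ^ i / (1 - q ^ r * (q ^ d) ^ i) ^ 2)) ≤ 1 := by
  have hu : cycVal m hm (1 - q ^ ((d : ℤ) * n - n)) ≤ unif := by
    obtain ⟨w, rfl⟩ := hmn
    exact cycVal_one_sub_q_zpow_le hm ⟨(d - 1) * w, by push_cast; ring⟩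
  have key : ∀ j : ℤ, j ≠ 0 →
      cycVal m hm ((1 - q ^ ((d : ℤ) * n - n)) ^ 2 * (q ^ j / (1 - q ^ j) ^ 2)) ≤ 1 := by
    intro j hj
    rw [map_mul, map_div₀, map_pow, map_pow, cycVal_q_zpow, mul_one_div, ← div_pow]
    exact pow_le_one' (div_le_one_of_le₀ (hu.trans (unif_le_cycVal_one_sub_q_zpow hm hj)) zero_le) 2
  have v2 : cycVal m hm (2 : RatFunc ℚ) ≤ 1 := by
    rw [← one_add_one_eq_two]
    exact Valuation.map_add_le _ (by simp) (by simp)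
  refine Valuation.map_sub_le _ (by simp) ?_
  rw [mul_right_comm, map_mul, mul_sum]
  refine mul_le_one' (Valuation.map_sum_le _ fun i _ => ?_)
    (Valuation.map_sub_le _ v2 (cycVal_q_zpow hm _).le)
  rw [mul_add, pow_mul_pow_eq_zpow, zpow_mul_pow]
  exact Valuation.map_add_le _ (key _ (by positivity)) (key _ (ne_zero_of_three_le hr hd i).1)

/-- The factor 1-u supplies Φ_m. Once (a²;p)_k is cancelled, the remaining quotient is integral by
counting factors. -/
theorem mainSide_congruence_of_dvd {m : ℕ} (hm : 1 < m) (hmn : m ∣ n) (hr : r = 1 ∨ r = -1)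
    (hd : 3 ≤ d) {N : ℕ} (hcop : IsCoprime (m : ℤ) (d : ℤ))
    (hN : (d : ℤ) * N = d * n - n - r) :
    cycVal m (by omega) (mainSide (q ^ r) (q ^ d) (q ^ ((d : ℤ) * n - n)) N) ≤ unif := by
  have hm0 : 0 < m := by omega
  have B := blockData_cyclotomic (r := r) (N := N) hm hd hcop (by
    obtain ⟨w, rfl⟩ := hmn
    exact ⟨(d - 1) * w, by rw [hN]; push_cast; ring⟩)
  have hu : cycVal m hm0 (1 - q ^ ((d : ℤ) * n - n)) ≤ unif := by
    obtain ⟨w, rfl⟩ := hmn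
    exact cycVal_one_sub_q_zpow_le hm0 ⟨(d - 1) * w, by push_cast; ring⟩
  have ha2 : ((q ^ r) ^ 2 : RatFunc ℚ) = q ^ (2 * r) := by
    rw [mul_comm, zpow_mul]; norm_cast
  have hpa : (q ^ d / q ^ r : RatFunc ℚ) = q ^ ((d : ℤ) - r) := by
    rw [zpow_sub₀ q_ne_zero, zpow_natCast]
  rw [mainSide, mul_sum]
  refine Valuation.map_sum_le _ fun k hk => ?_
  have hk : k ≤ N := by simpa [Nat.lt_succ_iff] using hk
  have n1 : poch ((q ^ r) ^ 2) (q ^ d : RatFunc ℚ) k ≠ 0 := poch_ne_zero fun i _ => by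
    rw [ha2, zpow_mul_pow]
    exact one_sub_q_zpow_ne_zero (ne_zero_of_three_le hr hd i).2
  have s : poch ((q ^ r) ^ 2) (q ^ d : RatFunc ℚ) N =
      poch ((q ^ r) ^ 2) (q ^ d) k * poch (q ^ (2 * r + d * k)) (q ^ d) (N - k) := by
    rw [← zpow_mul_pow, ← ha2, ← poch_add]; congr 1; omega
  have hbr := bracket_le_one (n := n) (d := d) (r := r) hm0 hr hd hmn k
  rw [s]
  generalize 1 - (1 - q ^ ((d : ℤ) * n - n)) ^ 2 * (2 - q ^ ((d : ℤ) * n - n)) *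
      ∑ i ∈ range k, (q ^ d * (q ^ d) ^ i / (1 - q ^ d * (q ^ d) ^ i) ^ 2 +
        q ^ r * (q ^ d) ^ i / (1 - q ^ r * (q ^ d) ^ i) ^ 2 : RatFunc ℚ) = b at *
  have e : (1 - q ^ ((d : ℤ) * n - n)) * ((q ^ r) ^ N)⁻¹ *
      (poch ((q ^ r) ^ 2) (q ^ d) k * poch (q ^ (2 * r + d * k)) (q ^ d) (N - k) /
        poch (q ^ d) (q ^ d) N) *
      (poch (q ^ r) (q ^ d) k ^ 3 * poch (q ^ d / q ^ r) (q ^ d) k * (q ^ d) ^ k /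
        (poch (q ^ d) (q ^ d) k ^ 3 * poch ((q ^ r) ^ 2) (q ^ d) k) * b) =
      (1 - q ^ ((d : ℤ) * n - n)) * (((q ^ r) ^ N)⁻¹ * (q ^ d) ^ k * b) *
        (poch (q ^ (2 * r + d * k)) (q ^ d) (N - k) * poch (q ^ ((d : ℤ) - r)) (q ^ d) k *
          poch (q ^ r) (q ^ d) k ^ 3 / (poch (q ^ d) (q ^ d) N * poch (q ^ d) (q ^ d) k ^ 3) :
            RatFunc ℚ) := by
    rw [← hpa]
    generalize poch ((q ^ r) ^ 2) (q ^ d : RatFunc ℚ) k = z at *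
    simp only [div_eq_mul_inv, mul_inv]
    have hz := mul_inv_cancel₀ n1
    linear_combination ((1 - q ^ ((d : ℤ) * n - n)) * (((q ^ r) ^ N)⁻¹ * (q ^ d) ^ k * b) *
        (poch (q ^ (2 * r + d * k)) (q ^ d) (N - k) * poch (q ^ d * (q ^ r)⁻¹) (q ^ d) k *
          poch (q ^ r) (q ^ d) k ^ 3 * ((poch (q ^ d) (q ^ d) N)⁻¹ *
            (poch (q ^ d) (q ^ d) k ^ 3)⁻¹))) * hz
  rw [e, map_mul, map_mul]
  refine mul_le_of_le_of_le_one (mul_le_of_le_of_le_one hu ?_) ?_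
  · rw [map_mul]
    exact mul_le_one' (by simp [cycVal_q]) hbr
  · rw [map_div₀]
    refine div_le_one_of_le₀ ?_ zero_le
    simp only [map_mul, map_pow, cycVal_poch_self hm0 hcop (show 0 < d by omega)]
    have h1 := cycVal_poch_le hm0 hcop (2 * r + d * k) (N - k)
    have h2 := cycVal_poch_le hm0 hcop ((d : ℤ) - r) k
    have h3 : cycVal m hm0 (poch (q ^ r) (q ^ d) k) ≤
        unif ^ (k / m + if N % m < k % m then 1 else 0) := by
      split_ifs with hlt
      · refine cycVal_poch_le_of_lt hm0 hcop (t := N % m) ?_ hlt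
        have := B.near_Q
        rw [zpow_mul_pow] at this
        by_contra hnd
        rw [cycVal_one_sub_q_zpow_eq_one hm0 hnd] at this
        exact absurd (this.trans_lt unif_lt_one) (lt_irrefl _)
      · exact cycVal_poch_le hm0 hcop r k
    refine (mul_le_mul' (mul_le_mul' h1 h2) (pow_le_pow_left' h3 3)).trans ?_
    rw [← pow_mul, ← pow_mul, ← pow_add, ← pow_add, ← pow_add]
    refine pow_le_pow_right_of_le_one' unif_lt_one.le ?_
    -- The indicator is the carry when N-k and k are added in base m; exactly then (q^r;q^d)_k has
    -- an additional factor Φ_m.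
    have key : N / m ≤ (N - k) / m + k / m + if N % m < k % m then 1 else 0 := by
      obtain ⟨l, rfl⟩ : ∃ l, N = l + k := ⟨N - k, by omega⟩
      rw [Nat.add_sub_cancel]
      have d1 := Nat.div_add_mod' l m
      have d2 := Nat.div_add_mod' k m
      have d3 := Nat.mod_lt l hm0
      have d4 := Nat.mod_lt k hm0
      rw [Nat.add_div hm0, Nat.add_mod l k m]
      split_ifs with g1 g2 g2
      · omega
      · exfalso
        rw [Nat.mod_eq_sub_mod g1, Nat.mod_eq_of_lt (by omega)] at g2
        omega
      · omega
      · omega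
    omega

end Main

end QSeries

/-! ### Assembly of the local congruences. -/

open QSeries
theorem theorem5p2 (n d : ℕ) (r : ℤ) (hr : r = 1 ∨ r = -1)
    (hd : 3 ≤ d) (hnd : (d : ℤ) ≤ n + r) (hcop : Nat.gcd n d = 1)
    (hmod : (n : ℤ) ≡ -r [ZMOD d])
    (M : ℕ) (hM : M = topIndex n d r ∨ M = n - 1) :
    RatCongr (modulus n) (lhsSum d r M)
      (qInt (d * n - n) * q ^ (r * (r + n - d * n) / d)
        * (qPoch (q ^ (2 * r)) (q ^ d) (topIndex n d r)
            / qPoch (q ^ d) (q ^ d) (topIndex n d r))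
        * ∑ k ∈ Finset.range (topIndex n d r + 1),
            (qPoch (q ^ r) (q ^ d) k ^ 3 * qPoch (q ^ ((d : ℤ) - r)) (q ^ d) k
                * q ^ ((d : ℤ) * k))
              / (qPoch (q ^ d) (q ^ d) k ^ 3 * qPoch (q ^ (2 * r)) (q ^ d) k)
            * (1 - qInt (d * n - n) ^ 2 * (2 - q ^ ((d : ℤ) * n - n)) * innerSum d r k)) := by
  have hN := mul_topIndex hd hnd hr hmod
  have hn : 1 < n := by rcases hr with rfl | rfl <;> omega
  rw [rhs_eq hN (by omega), lhsSum_eq]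
  generalize topIndex n d r = N at *
  have hd3 : (3 : ℤ) ≤ d := by exact_mod_cast hd
  have hdc : (d : ℤ) * (n - N) = n + r := by linear_combination -hN
  have hlt : (N : ℤ) < n := by
    by_contra hle
    push Not at hle
    nlinarith
  obtain ⟨c, rfl⟩ : ∃ c, n = N + c := ⟨n - N, by omega⟩
  have hc : 1 ≤ c := by omega
  -- From dc = n + r, n = N + c and d ≥ 3: 3c ≤ N + c + 1.
  have hcN : 2 * c ≤ N + 1 := by
    push_cast at hdc
    have : (3 : ℤ) * c ≤ d * c := by nlinarith
    rcases hr with rfl | rfl <;> · zify; linarith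
  have hco : IsCoprime ((N + c : ℕ) : ℤ) (d : ℤ) := Nat.isCoprime_iff_coprime.2 hcop
  have hval : ∀ m (hm : 1 < m), cycVal m (by omega) (1 - q)⁻¹ = 1 := by
    intro m hm
    have := cycVal_one_sub_q_zpow_eq_one (m := m) (by omega) (j := 1) (by
      intro hdv
      have := Int.le_of_dvd one_pos hdv
      omega)
    rw [zpow_one] at this
    rw [map_inv₀, this, inv_one]
  refine ratCongr_modulus hn ?_ fun m hm hmn _ => ?_
  · rw [← mul_sub, map_mul, hval _ hn, one_mul]
    exact top_congruence _ hr hd hco hN rfl hc hcN hM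
  · have hcm : IsCoprime (m : ℤ) (d : ℤ) :=
      hco.of_isCoprime_of_dvd_left (Int.natCast_dvd_natCast.2 hmn)
    rw [← mul_sub, map_mul, hval m hm, one_mul]
    exact Valuation.map_sub_le _ (lhs_congruence_of_dvd hm hmn hd (by omega) hcm hN hM)
      (mainSide_congruence_of_dvd hm hmn hr hd hcm hN)
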